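/- **Setting.** Let $\mathcal X,\mathcal Z$ be finite alphabets, let $X=(X_i)_{i\in\mathbb Z}$ be a stationary ergodic $\mathcal X$-valued process, and let $Z=(Z_i)_{i\in\mathbb Z}$ be the $\mathcal Z$-valued output of a memoryless channel with transition probabilities $p_{Z|X}(z|x)$ and input $X$. Suppose the channel matrix $(p_{Z|X}(z|x))_{x,z}$ is invertible, in the sense that its rows $p_{Z|X}(\cdot|x)$, $x\in\mathcal X$, are linearly independent (for $|\mathcal X|=|\mathcal Z|$ this is ordinary invertibility). Suppose $(X,Z)$ is double-sided mixing: it is jointly stationary and $\delta_k\to0$ as $k\to\infty$, where $$\delta_k=\operatorname*{ess\,sup}_{Z_{-\infty}^{\infty}}\ \max_{x_0\in\mathcal X}\bigl|P(X_0=x_0\mid Z_{-k}^{k})-P(X_0=x_0\mid Z_{-\infty}^{\infty})\bigr| .$$ Put $\rho(z,y)=-\log p_{Z|X}(z|y)\in[0,\infty]$ for $z\in\mathcal Z$, $y\in\mathcal X$ (with $-\log 0=\infty$), $\rho_n(z^n,y^n)=\frac1n\sum_{i=1}^n\rho(z_i,y_i)$, and $D=H(Z_0|X_0)$. Let $$R(Z^k,D)=\inf\Bigl\{\tfrac1k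 I(Z^k;Y^k)\ :\ P_{Y^k|Z^k}\text{ with } \mathbb E\,\rho_k(Z^k,Y^k)\le D\Bigr\},\qquad R(Z,D)=\lim_{k\to\infty}R(Z^k,D),$$ where $Y^k$ takes values in $\mathcal X^k$. For each $n$ let $Y^n$ be an $\mathcal X^n$-valued reconstruction of $Z^n=(Z_1,\dots,Z_n)$, possibly randomized, so that $X^n - Z^n - Y^n$ is a Markov chain (for instance $Y^n=\phi_n(Z^n)$ for a deterministic code $\phi_n$). Suppose $(Y^n)_n$ is good for $Z$ at distortion level $D$, that is, $$\limsup_{n\to\infty}\tfrac1n H(Y^n)\le R(Z,D),\qquad \limsup_{n\to\infty}\mathbb E\,\rho_n(Z^n,Y^n)\le D .$$ **Theorem.** For every $\Lambda_{\max}$ and every loss function $\Lambda:\mathcal X\times\mathcal X\to[0,\Lambda_{\max}]$, $$\lim_{n\to\infty}\mathbb E\Bigl[\frac1n\sum_{i=1}^n\Lambda(X_i,Y_i)\Bigr]=\mathbb E_{Z_{-\infty}^{\infty}}\Bigl[\mathbb E_{(U,V)\sim P_{X_0|Z_{-\infty}^{\infty}}\times P_{X_0|Z_{-\infty}^{\infty}}}\Lambda(U,V)\Bigr],$$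 where $Y_i$ is the $i$-th coordinate of $Y^n$. In particular the limit exists. -/

import Mathlib

open MeasureTheory ProbabilityTheory Filter Topology
open scoped ENNReal

namespace Denoising

noncomputable section

/-! ### Processes -/

/-- The whole sample path `(…, X₋₁, X₀, X₁, …)` of a double-sided process. -/
def path {Ω A : Type*} (X : ℤ → Ω → A) (ω : Ω) : ℤ → A := fun i => X i ω

/-- The block `Xⁿ = (X₁, …, Xₙ)`. -/
def block {Ω A : Type*} (X : ℤ → Ω → A) (n : ℕ) (ω : Ω) : Fin n → A :=
  fun i => X ((i : ℤ) + 1) ω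

/-- The coordinates `(z₋ₖ, …, zₖ)` of a double-sided sequence. -/
def window {B : Type*} (k : ℕ) (z : ℤ → B) : Finset.Icc (-(k : ℤ)) k → B := fun i => z i

/-- The left shift on double-sided sequences. -/
def shift {A : Type*} (s : ℤ → A) : ℤ → A := fun i => s (i + 1)

/-- A stationary process: its law is invariant under the shift. -/
def IsStationary {Ω A : Type*} [MeasurableSpace Ω] [MeasurableSpace A]
    (μ : Measure Ω) (X : ℤ → Ω → A) : Prop :=
  MeasurePreserving shift (μ.map (path X)) (μ.map (path X))

/-- A stationary ergodic process (Mathlib's `Ergodic` includes invariance of the measure). -/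
def IsStationaryErgodic {Ω A : Type*} [MeasurableSpace Ω] [MeasurableSpace A]
    (μ : Measure Ω) (X : ℤ → Ω → A) : Prop :=
  Ergodic shift (μ.map (path X))

/-- For a finite-valued `V`: `U` and `W` are conditionally independent given `V`, that is,
`U — V — W` is a Markov chain. -/
def IsMarkovChain {Ω α β γ : Type*} [MeasurableSpace Ω] [MeasurableSpace α] [MeasurableSpace γ]
    (μ : Measure Ω) (U : Ω → α) (V : Ω → β) (W : Ω → γ) : Prop :=
  ∀ v : β, IndepFun U W (cond μ (V ⁻¹' {v}))

/-! ### Channels -/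

/-- A stochastic matrix with rows indexed by the inputs: `W x z` is the probability of the
output `z` given the input `x`. -/
structure IsChannel {A B : Type*} [Fintype B] (W : Matrix A B ℝ) : Prop where
  nonneg : ∀ x z, 0 ≤ W x z
  sum_eq_one : ∀ x, ∑ z, W x z = 1

/-- `Z` is the output of the memoryless channel `W` with input process `X`: given the inputs,
the outputs at distinct times are independent with laws `W (X i) ·`. -/
def IsMemorylessOutput {Ω A B : Type*} [MeasurableSpace Ω] (μ : Measure Ω)
    (X : ℤ → Ω → A) (Z : ℤ → Ω → B) (W : Matrix A B ℝ) : Prop :=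
  ∀ (s : Finset ℤ) (x : ℤ → A) (z : ℤ → B),
    μ.real {ω | ∀ i ∈ s, X i ω = x i ∧ Z i ω = z i} =
      μ.real {ω | ∀ i ∈ s, X i ω = x i} * ∏ i ∈ s, W (x i) (z i)

/-! ### Information measures on finite alphabets (natural logarithms) -/

/-- The Shannon entropy `H(U)`. -/
def entropy {Ω α : Type*} [MeasurableSpace Ω] [Fintype α] (μ : Measure Ω) (U : Ω → α) : ℝ :=
  ∑ u, Real.negMulLog (μ.real (U ⁻¹' {u}))

/-- The conditional entropy `H(U | V) = ∑ᵥ P(V = v) H(U | V = v)`. -/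
def condEntropy {Ω α β : Type*} [MeasurableSpace Ω] [Fintype α] [Fintype β]
    (μ : Measure Ω) (U : Ω → α) (V : Ω → β) : ℝ :=
  ∑ v, μ.real (V ⁻¹' {v}) * entropy (cond μ (V ⁻¹' {v})) U

/-- The mutual information of a pair with joint probability mass function `J`. -/
def mutualInfo {α β : Type*} [Fintype α] [Fintype β] (J : α → β → ℝ) : ℝ :=
  ∑ a, ∑ b, J a b * Real.log (J a b / ((∑ b', J a b') * ∑ a', J a' b))

/-! ### Distortion, the rate-distortion function, good codes -/

/-- The block distortion `ρₙ(zⁿ, yⁿ) = (1/n) ∑ᵢ ρ(zᵢ, yᵢ)`. -/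
def blockDistortion {B Y : Type*} (ρ : B → Y → ℝ≥0∞) {n : ℕ} (z : Fin n → B) (y : Fin n → Y) :
    ℝ≥0∞ :=
  (∑ i, ρ (z i) (y i)) / n

/-- `R(Zᵏ, D)`: the infimum of `(1/k) I(Zᵏ; Yᵏ)` over all conditional probability mass functions
`V` of `Yᵏ` given `Zᵏ` with `E ρₖ(Zᵏ, Yᵏ) ≤ D` (it is `⊤` if there are none). -/
def blockRateDistortion {Ω B Y : Type*} [MeasurableSpace Ω] [Fintype B] [Fintype Y]
    (μ : Measure Ω) (Z : ℤ → Ω → B) (ρ : B → Y → ℝ≥0∞) (D : ℝ≥0∞) (k : ℕ) : EReal :=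
  ⨅ V ∈ {V : Matrix (Fin k → B) (Fin k → Y) ℝ | IsChannel V ∧
      ∑ z, ∑ y, ENNReal.ofReal (μ.real (block Z k ⁻¹' {z}) * V z y) * blockDistortion ρ z y ≤ D},
    ((mutualInfo (fun z y => μ.real (block Z k ⁻¹' {z}) * V z y) / k : ℝ) : EReal)

/-- `R(Z, D) = lim_k R(Zᵏ, D)`. -/
def rateDistortion {Ω B Y : Type*} [MeasurableSpace Ω] [Fintype B] [Fintype Y]
    (μ : Measure Ω) (Z : ℤ → Ω → B) (ρ : B → Y → ℝ≥0∞) (D : ℝ≥0∞) : EReal :=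
  limUnder atTop (blockRateDistortion μ Z ρ D)

/-- The reconstructions `Yⁿ` of `Zⁿ` are good at distortion level `D`, that is, at the point
`(R(Z, D), D)` of the rate-distortion curve:
`limsup (1/n) H(Yⁿ) ≤ R(Z, D)` and `limsup E ρₙ(Zⁿ, Yⁿ) ≤ D`. -/
structure IsGood {Ω B Y : Type*} [MeasurableSpace Ω] [Fintype B] [Fintype Y]
    (μ : Measure Ω) (Z : ℤ → Ω → B) (ρ : B → Y → ℝ≥0∞) (D : ℝ≥0∞)
    (Yhat : (n : ℕ) → Ω → Fin n → Y) : Prop where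
  rate_le : limsup (fun n : ℕ => ((entropy μ (Yhat n) / n : ℝ) : EReal)) atTop
    ≤ rateDistortion μ Z ρ D
  distortion_le :
    limsup (fun n : ℕ => ∫⁻ ω, blockDistortion ρ (block Z n ω) (Yhat n ω) ∂μ) atTop ≤ D

/-- The distortion `ρ(z, y) = -log p_{Z|X}(z | y)` matched to the channel, with `-log 0 = ∞`. -/
def channelDistortion {A B : Type*} (W : Matrix A B ℝ) (z : B) (y : A) : ℝ≥0∞ :=
  open Classical in if W y z = 0 then ⊤ else ENNReal.ofReal (-Real.log (W y z))

/-! ### The double-sided mixing coefficient -/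

/-- The posterior distribution `P_{X₀ | Z}` of `X₀` given the whole path of `Z`. -/
def posterior {Ω A B : Type*} [MeasurableSpace Ω] [Nonempty A] [MeasurableSpace A]
    [StandardBorelSpace A] [MeasurableSpace B] (μ : Measure Ω) [IsFiniteMeasure μ]
    (X : ℤ → Ω → A) (Z : ℤ → Ω → B) : Kernel (ℤ → B) A :=
  condDistrib (X 0) (path Z) μ

/-- The posterior distribution of `X₀` given `(Z₋ₖ, …, Zₖ)`. -/
def windowPosterior {Ω A B : Type*} [MeasurableSpace Ω] [Nonempty A] [MeasurableSpace A]
    [StandardBorelSpace A] [MeasurableSpace B] (μ : Measure Ω) [IsFiniteMeasure μ]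
    (X : ℤ → Ω → A) (Z : ℤ → Ω → B) (k : ℕ) : Kernel (Finset.Icc (-(k : ℤ)) k → B) A :=
  condDistrib (X 0) (fun ω => window k (path Z ω)) μ

/-- The double-sided mixing coefficient `δₖ`: the essential supremum, over the law of the path
of `Z`, of `maxₓ |P(X₀ = x | Z₋ₖ, …, Zₖ) - P(X₀ = x | Z)|`. -/
def mixingCoeff {Ω A B : Type*} [MeasurableSpace Ω] [Nonempty A] [MeasurableSpace A]
    [StandardBorelSpace A] [MeasurableSpace B] (μ : Measure Ω) [IsFiniteMeasure μ]
    (X : ℤ → Ω → A) (Z : ℤ → Ω → B) (k : ℕ) : ℝ≥0∞ :=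
  essSup (fun z : ℤ → B => ⨆ x : A,
      ‖(windowPosterior μ X Z k (window k z)).real {x} - (posterior μ X Z z).real {x}‖ₑ)
    (μ.map (path Z))

/-- `(X, Z)` is double-sided mixing: jointly stationary, with `δₖ → 0`. -/
structure IsDoubleSidedMixing {Ω A B : Type*} [MeasurableSpace Ω] [Nonempty A]
    [MeasurableSpace A] [StandardBorelSpace A] [MeasurableSpace B] (μ : Measure Ω)
    [IsFiniteMeasure μ] (X : ℤ → Ω → A) (Z : ℤ → Ω → B) : Prop where
  stationary : IsStationary μ (fun i ω => (X i ω, Z i ω))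
  tendsto_zero : Tendsto (mixingCoeff μ X Z) atTop (𝓝 0)

/-! ### Loss -/

/-- The block loss `Λₙ(xⁿ, yⁿ) = (1/n) ∑ᵢ Λ(xᵢ, yᵢ)`. -/
def blockLoss {A Y : Type*} (Λ : A → Y → ℝ) {n : ℕ} (x : Fin n → A) (y : Fin n → Y) : ℝ :=
  (∑ i, Λ (x i) (y i)) / n

end

end Denoising

namespace Denoising

/-! ### Divergence inequalities on finite types -/

/-! Put `D = H(Z₀|X₀)`. The divergence of the law of `(Zⁿ, Yⁿ)` from the law of `Yⁿ` sent through
the memoryless channel is `n E ρₙ(Zⁿ, Yⁿ) - H(Zⁿ|Yⁿ)`, hence at most `n E ρₙ(Zⁿ, Yⁿ) - H(Zⁿ) +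
H(Yⁿ)`. At level `D` the Shannon lower bound is tight, because `Xⁿ` is itself an admissible
reconstruction and `Zⁿ` is its channel output. So `R(Z, D)` is the entropy rate of `Z` minus `D`
(`rateDistortion_eq`), and goodness makes the divergence `o(n)` (`IsGood.eventually_le`).

Since the channel is memoryless and conditional entropy is subadditive, the divergence is
superadditive over adjacent blocks. Its average over all sliding windows of a fixed length therefore
vanishes (`sum_channelGap_le`), and a Pinsker-type bound turns this into closeness in total
variation. A window of `Z` has the law of the output for the true input, and an invertible channel
determines the input law from the output law. Hence, on average over windows, `(Z, Y)` has nearly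
the same law as `(Z, X)` (`exists_abs_integral_seqBlock_sub_le`).

It remains to reduce the loss to windows of `(Z, Y)`. By the Markov property `Yᵢ` acts on `Xᵢ` only
through `Zⁿ`, and by mixing the posterior of `Xᵢ` is nearly a function of a window of `Z`; so the
expected loss is nearly the expectation of a function of a window of `Z` and of `Yᵢ`
(`abs_integral_loss_sub_blockWindowLoss_le`). There `Yᵢ` may be replaced by the true letter, and
conditioning on `Z` turns that letter into a second draw from the posterior
(`abs_integral_windowLoss_sub_le`). -/

lemma mul_log_sub_log_ge {p q : ℝ} (hp : 0 ≤ p) (hq : 0 ≤ q) (hpq : 0 < p → 0 < q) :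
    (√p - √q) ^ 2 ≤ p * (Real.log p - Real.log q) - p + q := by
  rcases hp.eq_or_lt with rfl | hp0
  · simp [Real.sq_sqrt hq]
  · have hq0 := hpq hp0
    have hsp := Real.sqrt_pos.2 hp0
    have hsq := Real.sqrt_pos.2 hq0
    -- Applying `1 - 1/t ≤ log t` at `t = √p / √q` rather than `p / q` is what produces the
    -- Hellinger square.
    have h := Real.one_sub_inv_le_log_of_pos (div_pos hsp hsq)
    rw [Real.log_div hsp.ne' hsq.ne', Real.log_sqrt hp0.le, Real.log_sqrt hq0.le, inv_div] at h
    have h2 := mul_le_mul_of_nonneg_left h hp0.le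
    have h3 : p * (√q / √p) = √p * √q := by
      rw [mul_div_assoc', div_eq_iff hsp.ne']
      nlinarith [Real.sq_sqrt hp0.le]
    nlinarith [Real.sq_sqrt hp0.le, Real.sq_sqrt hq0.le]

/-- Factor `p - q = (√p - √q)(√p + √q)`, apply AM-GM with weight `ε`, and use `(√p + √q)² ≤ 2(p +
q)`. -/
lemma abs_sub_le_mul_log {p q ε : ℝ} (hp : 0 ≤ p) (hq : 0 ≤ q) (hpq : 0 < p → 0 < q)
    (hε : 0 < ε) :
    |p - q| ≤ (p * (Real.log p - Real.log q) - p + q) / (2 * ε) + ε * (p + q) := by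
  refine le_trans ?_ (add_le_add_left
    (div_le_div_of_nonneg_right (mul_log_sub_log_ge hp hq hpq) (by positivity)) _)
  set a := √p with ha
  set b := √q with hb
  have hpa : p = a ^ 2 := (Real.sq_sqrt hp).symm
  have hqb : q = b ^ 2 := (Real.sq_sqrt hq).symm
  have ha0 : 0 ≤ a := Real.sqrt_nonneg _
  have hb0 : 0 ≤ b := Real.sqrt_nonneg _
  rw [hpa, hqb, div_add' _ _ _ (by positivity), le_div_iff₀ (by positivity),
    show a ^ 2 - b ^ 2 = (a - b) * (a + b) by ring, abs_mul, abs_of_nonneg (add_nonneg ha0 hb0)]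
  have h1 : |a - b| ^ 2 = (a - b) ^ 2 := sq_abs _
  nlinarith [sq_nonneg (|a - b| - ε * (a + b)), mul_nonneg (sq_nonneg ε) (sq_nonneg (a - b))]

/-- Gibbs' inequality. Only an upper bound on the mass of `q` is required, since some comparison
weights used below may lose mass. -/
lemma sum_mul_log_nonneg {T : Type*} [Fintype T] {p q : T → ℝ} (hp : ∀ t, 0 ≤ p t)
    (hq : ∀ t, 0 ≤ q t) (hpq : ∀ t, 0 < p t → 0 < q t) (hsum : ∑ t, q t ≤ ∑ t, p t) :
    0 ≤ ∑ t, p t * (Real.log (p t) - Real.log (q t)) := by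
  have h := Finset.sum_le_sum fun t (_ : t ∈ Finset.univ) =>
    (sq_nonneg _).trans (mul_log_sub_log_ge (hp t) (hq t) (hpq t))
  simp only [Finset.sum_add_distrib, Finset.sum_sub_distrib, Finset.sum_const_zero] at h
  linarith

/-- A Pinsker inequality with a free parameter in place of the square root. Being linear in the
divergence, it can be summed over windows when only the total divergence is controlled. -/
lemma sum_abs_sub_le {T : Type*} [Fintype T] {p q : T → ℝ} (hp : ∀ t, 0 ≤ p t)
    (hq : ∀ t, 0 ≤ q t) (hpq : ∀ t, 0 < p t → 0 < q t) (hp1 : ∑ t, p t = 1) (hq1 : ∑ t, q t = 1)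
    {ε : ℝ} (hε : 0 < ε) :
    ∑ t, |p t - q t| ≤ (∑ t, p t * (Real.log (p t) - Real.log (q t))) / (2 * ε) + 2 * ε := by
  have h := Finset.sum_le_sum fun t (_ : t ∈ Finset.univ) =>
    abs_sub_le_mul_log (hp t) (hq t) (hpq t) hε
  rw [Finset.sum_add_distrib, ← Finset.sum_div, ← Finset.mul_sum, Finset.sum_add_distrib,
    Finset.sum_add_distrib, Finset.sum_sub_distrib, hp1, hq1] at h
  simpa [mul_comm, one_add_one_eq_two] using h

/-! ### Finite-valued random variables -/

section FiniteValued

variable {Ω α β : Type*} [MeasurableSpace Ω] {μ : Measure Ω}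

lemma integrable_comp_fintype [IsFiniteMeasure μ] [Finite α] [MeasurableSpace α]
    [MeasurableSingletonClass α] {T : Ω → α} (hT : Measurable T) (f : α → ℝ) :
    Integrable (fun ω => f (T ω)) μ :=
  (Integrable.of_finite (f := f) (μ := μ.map T)).comp_measurable hT

lemma integral_comp_fintype [IsFiniteMeasure μ] [Fintype α] [MeasurableSpace α]
    [MeasurableSingletonClass α] {T : Ω → α} (hT : Measurable T) (f : α → ℝ) :
    ∫ ω, f (T ω) ∂μ = ∑ t, μ.real (T ⁻¹' {t}) * f t := by
  rw [← integral_map hT.aemeasurable (measurable_of_finite f).aestronglyMeasurable,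
    integral_fintype Integrable.of_finite]
  simp [map_measureReal_apply hT]

lemma sum_measureReal_fiber [IsProbabilityMeasure μ] [Fintype α] [MeasurableSpace α]
    [MeasurableSingletonClass α] {T : Ω → α} (hT : Measurable T) :
    ∑ t, μ.real (T ⁻¹' {t}) = 1 := by
  simpa using (integral_comp_fintype (μ := μ) hT fun _ => (1 : ℝ)).symm

lemma sum_measureReal_fiber_pair [IsFiniteMeasure μ] [Fintype α] [MeasurableSpace α]
    [MeasurableSingletonClass α]
    {S : Ω → α} {V : Ω → β} (hS : Measurable S) (v : β) :
    ∑ s, μ.real ((fun ω => (S ω, V ω)) ⁻¹' {(s, v)}) = μ.real (V ⁻¹' {v}) := by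
  have h := sum_measureReal_preimage_singleton (μ := μ.restrict (V ⁻¹' {v})) Finset.univ
    (f := S) (fun y _ => hS (measurableSet_singleton y))
  simp only [Finset.coe_univ, Set.preimage_univ, measureReal_restrict_apply_univ] at h
  rw [← h]
  refine Finset.sum_congr rfl fun s _ => ?_
  rw [measureReal_restrict_apply (hS (measurableSet_singleton s))]
  congr 1
  ext ω
  simp

/-- The probability of the atom of `U` that contains `ω`. -/
noncomputable def atomProb (μ : Measure Ω) (U : Ω → α) (ω : Ω) : ℝ := μ.real (U ⁻¹' {U ω})

/-- Information content depends only on the partition a variable induces, so tuples and concatenated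
blocks can be regrouped without explicit bijections. -/
lemma atomProb_congr {U : Ω → α} {U' : Ω → β} (h : ∀ ω ω', U ω = U ω' ↔ U' ω = U' ω') (ω : Ω) :
    atomProb μ U ω = atomProb μ U' ω := by
  unfold atomProb
  congr 1
  ext ω'
  simp [h]

lemma ae_atomProb_pos [IsFiniteMeasure μ] [Finite α] [MeasurableSpace α]
    [MeasurableSingletonClass α] {T : Ω → α} (hT : Measurable T) :
    ∀ᵐ ω ∂μ, 0 < atomProb μ T ω := by
  have h : ∀ᵐ t ∂(μ.map T), 0 < μ.real (T ⁻¹' {t}) := by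
    rw [ae_iff_of_countable]
    intro t ht
    rw [Measure.map_apply hT (measurableSet_singleton t)] at ht
    exact ENNReal.toReal_pos ht (measure_ne_top _ _)
  exact ae_of_ae_map hT.aemeasurable h

lemma atomProb_pair_le_left [IsFiniteMeasure μ] (S : Ω → α) (V : Ω → β) (ω : Ω) :
    atomProb μ (fun ω => (S ω, V ω)) ω ≤ atomProb μ S ω :=
  measureReal_mono (fun ω' h => by simp at h ⊢; exact h.1)

lemma integrable_log_atomProb [IsFiniteMeasure μ] [Finite α] [MeasurableSpace α]
    [MeasurableSingletonClass α] {T : Ω → α} (hT : Measurable T) :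
    Integrable (fun ω => Real.log (atomProb μ T ω)) μ :=
  integrable_comp_fintype hT fun t => Real.log (μ.real (T ⁻¹' {t}))

lemma integral_log_atomProb [IsFiniteMeasure μ] [Fintype α] [MeasurableSpace α]
    [MeasurableSingletonClass α] {T : Ω → α} (hT : Measurable T) :
    ∫ ω, Real.log (atomProb μ T ω) ∂μ = -entropy μ T := by
  rw [entropy, ← Finset.sum_neg_distrib]
  refine (integral_comp_fintype hT fun t => Real.log (μ.real (T ⁻¹' {t}))).trans ?_
  simp [Real.negMulLog]

lemma integral_log_atomProb_sub_nonneg [IsProbabilityMeasure μ] [Fintype α] [MeasurableSpace α]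
    [MeasurableSingletonClass α] {T : Ω → α} (hT : Measurable T) {q : α → ℝ}
    (hq : ∀ t, 0 ≤ q t) (hpq : ∀ t, 0 < μ.real (T ⁻¹' {t}) → 0 < q t) (hsum : ∑ t, q t ≤ 1) :
    0 ≤ ∫ ω, (Real.log (atomProb μ T ω) - Real.log (q (T ω))) ∂μ := by
  refine le_of_le_of_eq ?_
    (integral_comp_fintype hT fun t => Real.log (μ.real (T ⁻¹' {t})) - Real.log (q t)).symm
  exact sum_mul_log_nonneg (fun _ => measureReal_nonneg) hq hpq
    (hsum.trans_eq (sum_measureReal_fiber hT).symm)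

/-- The conditional entropy `H(S | V)` as an expected conditional information content. -/
noncomputable def condInfo (μ : Measure Ω) (S : Ω → α) (V : Ω → β) : ℝ :=
  ∫ ω, (Real.log (atomProb μ V ω) - Real.log (atomProb μ (fun ω => (S ω, V ω)) ω)) ∂μ

end FiniteValued

/-! ### Conditional entropy and divergence from a channel -/

section CondInfo

variable {Ω α β α' β' : Type*} [MeasurableSpace Ω] {μ : Measure Ω} [IsProbabilityMeasure μ]
  [Fintype α] [MeasurableSpace α] [MeasurableSingletonClass α]
  [Fintype β] [MeasurableSpace β] [MeasurableSingletonClass β]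
  [Fintype α'] [MeasurableSpace α'] [MeasurableSingletonClass α']
  [Fintype β'] [MeasurableSpace β'] [MeasurableSingletonClass β']

omit [Fintype α] [MeasurableSpace α] [MeasurableSingletonClass α] [Fintype β]
  [MeasurableSpace β] [MeasurableSingletonClass β] in
lemma measureReal_fiber_pair_le (S : Ω → α) (V : Ω → β) (s : α) (v : β) :
    μ.real ((fun ω => (S ω, V ω)) ⁻¹' {(s, v)}) ≤ μ.real (V ⁻¹' {v}) :=
  measureReal_mono (fun ω' h => by simp at h ⊢; exact h.2)

lemma condInfo_eq {S : Ω → α} {V : Ω → β} (hS : Measurable S) (hV : Measurable V) :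
    condInfo μ S V = ∫ ω, Real.log (atomProb μ V ω) ∂μ -
      ∫ ω, Real.log (atomProb μ (fun ω => (S ω, V ω)) ω) ∂μ :=
  integral_sub (integrable_log_atomProb hV) (integrable_log_atomProb (hS.prodMk hV))

/-- Gibbs' inequality for the joint law against `P(v, v') P(s|v) P(s'|v')`. -/
lemma condInfo_pair_le {S : Ω → α} {S' : Ω → α'} {V : Ω → β} {V' : Ω → β'}
    (hS : Measurable S) (hS' : Measurable S') (hV : Measurable V) (hV' : Measurable V') :
    condInfo μ (fun ω => (S ω, S' ω)) (fun ω => (V ω, V' ω)) ≤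
      condInfo μ S V + condInfo μ S' V' := by
  have hSV := hS.prodMk hV
  have hSV' := hS'.prodMk hV'
  have hVV := hV.prodMk hV'
  have hT := (hS.prodMk hS').prodMk hVV
  let q : (α × α') × β × β' → ℝ := fun t =>
    μ.real ((fun ω => (V ω, V' ω)) ⁻¹' {t.2}) *
      (μ.real ((fun ω => (S ω, V ω)) ⁻¹' {(t.1.1, t.2.1)}) / μ.real (V ⁻¹' {t.2.1})) *
      (μ.real ((fun ω => (S' ω, V' ω)) ⁻¹' {(t.1.2, t.2.2)}) / μ.real (V' ⁻¹' {t.2.2}))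
  have hpos : ∀ t, 0 < μ.real ((fun ω => ((S ω, S' ω), V ω, V' ω)) ⁻¹' {t}) → 0 < q t := by
    rintro ⟨⟨s, s'⟩, v, v'⟩ h
    refine mul_pos (mul_pos ?_ (div_pos ?_ ?_)) (div_pos ?_ ?_) <;>
    · refine h.trans_le (measureReal_mono fun ω hω => ?_)
      simp only [Set.mem_preimage, Set.mem_singleton_iff, Prod.mk.injEq] at hω ⊢
      tauto
  have hsum : ∑ t, q t ≤ 1 := by
    rw [← sum_measureReal_fiber (μ := μ) hVV, Fintype.sum_prod_type_right]
    refine Finset.sum_le_sum fun v _ => ?_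
    rw [Fintype.sum_prod_type]
    simp only [q, mul_assoc, ← Finset.mul_sum, ← Finset.sum_div, ← Finset.sum_mul,
      sum_measureReal_fiber_pair hS, sum_measureReal_fiber_pair hS']
    -- A quotient `P(V = v) / P(V = v)` is `0` at null values, so each conditional mass is only
    -- bounded by one.
    exact mul_le_of_le_one_right measureReal_nonneg
      (mul_le_one₀ (div_self_le_one _) (by positivity) (div_self_le_one _))
  have hq0 : ∀ t, 0 ≤ q t := fun t => by positivity
  have h := integral_log_atomProb_sub_nonneg hT hq0 hpos hsum
  have i1 := integrable_log_atomProb (μ := μ) hSV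
  have i2 := integrable_log_atomProb (μ := μ) hSV'
  have i3 := integrable_log_atomProb (μ := μ) hVV
  have i4 := integrable_log_atomProb (μ := μ) hT
  have i5 := integrable_log_atomProb (μ := μ) hV
  have i6 := integrable_log_atomProb (μ := μ) hV'
  have key : ∫ ω, (Real.log (atomProb μ (fun ω => ((S ω, S' ω), V ω, V' ω)) ω) -
      Real.log (q ((S ω, S' ω), V ω, V' ω))) ∂μ =
      ∫ ω, ((((((fun ω => Real.log (atomProb μ V ω)) - fun ω =>
        Real.log (atomProb μ (fun ω => (S ω, V ω)) ω)) + fun ω => Real.log (atomProb μ V' ω)) -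
        fun ω => Real.log (atomProb μ (fun ω => (S' ω, V' ω)) ω)) - fun ω =>
        Real.log (atomProb μ (fun ω => (V ω, V' ω)) ω)) + fun ω =>
        Real.log (atomProb μ (fun ω => ((S ω, S' ω), V ω, V' ω)) ω)) ω ∂μ := by
    refine integral_congr_ae ?_
    filter_upwards [ae_atomProb_pos (μ := μ) hSV, ae_atomProb_pos (μ := μ) hSV',
      ae_atomProb_pos (μ := μ) hVV, ae_atomProb_pos (μ := μ) hV, ae_atomProb_pos (μ := μ) hV']
      with ω h1 h2 h3 h5 h6
    have hq : q ((S ω, S' ω), V ω, V' ω) = atomProb μ (fun ω => (V ω, V' ω)) ω *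
        (atomProb μ (fun ω => (S ω, V ω)) ω / atomProb μ V ω) *
        (atomProb μ (fun ω => (S' ω, V' ω)) ω / atomProb μ V' ω) := rfl
    rw [hq, Real.log_mul (by positivity) (by positivity), Real.log_mul (by positivity)
      (by positivity), Real.log_div h1.ne' h5.ne', Real.log_div h2.ne' h6.ne']
    simp only [Pi.sub_apply, Pi.add_apply]
    ring
  rw [key, integral_add' ((((i5.sub i1).add i6).sub i2).sub i3) i4,
    integral_sub' (((i5.sub i1).add i6).sub i2) i3, integral_sub' ((i5.sub i1).add i6) i2,
    integral_add' (i5.sub i1) i6, integral_sub' i5 i1] at h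
  rw [condInfo_eq hS hV, condInfo_eq hS' hV', condInfo_eq (hS.prodMk hS') hVV]
  linarith

/-- The divergence of the law of `(S, V)` from the law of `V` followed by the channel `w`. -/
lemma integral_sub_condInfo {S : Ω → α} {V : Ω → β} (hS : Measurable S) (hV : Measurable V)
    {w : β → α → ℝ} (hpos : ∀ᵐ ω ∂μ, 0 < w (V ω) (S ω)) :
    ∫ ω, -Real.log (w (V ω) (S ω)) ∂μ - condInfo μ S V =
      ∑ t : α × β, μ.real ((fun ω => (S ω, V ω)) ⁻¹' {t}) *
        (Real.log (μ.real ((fun ω => (S ω, V ω)) ⁻¹' {t})) -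
          Real.log (μ.real (V ⁻¹' {t.2}) * w t.2 t.1)) := by
  have hSV := hS.prodMk hV
  rw [← integral_comp_fintype hSV fun t => Real.log (μ.real ((fun ω => (S ω, V ω)) ⁻¹' {t})) -
          Real.log (μ.real (V ⁻¹' {t.2}) * w t.2 t.1), condInfo_eq hS hV, sub_sub_eq_add_sub,
    ← integral_add' (integrable_comp_fintype hSV fun t => -Real.log (w t.2 t.1))
      (integrable_log_atomProb hSV), ← integral_sub' ((integrable_comp_fintype hSV fun t =>
        -Real.log (w t.2 t.1)).add (integrable_log_atomProb hSV)) (integrable_log_atomProb hV)]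
  refine integral_congr_ae ?_
  filter_upwards [hpos, ae_atomProb_pos (μ := μ) hV] with ω h1 h2
  simp only [Pi.sub_apply, Pi.add_apply]
  unfold atomProb at *
  rw [Real.log_mul h2.ne' h1.ne']
  ring

omit [Fintype α] [MeasurableSpace α] [MeasurableSingletonClass α] [Fintype β]
  [MeasurableSpace β] [MeasurableSingletonClass β] in
-- The absolute continuity needed by Gibbs' inequality: an atom on which the channel probability
-- vanishes would lie in the exceptional null set.
lemma pos_of_measureReal_pos {S : Ω → α} {V : Ω → β}
    {w : β → α → ℝ} (hpos : ∀ᵐ ω ∂μ, 0 < w (V ω) (S ω)) (t : α × β)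
    (ht : 0 < μ.real ((fun ω => (S ω, V ω)) ⁻¹' {t})) :
    0 < μ.real (V ⁻¹' {t.2}) * w t.2 t.1 := by
  refine mul_pos (ht.trans_le (measureReal_fiber_pair_le S V t.1 t.2)) ?_
  by_contra hneg
  refine ht.ne' ?_
  rw [measureReal_eq_zero_iff]
  refine measure_mono_null (fun ω hω => ?_) (ae_iff.1 hpos)
  simp only [Set.mem_preimage, Set.mem_singleton_iff] at hω
  rw [← hω] at hneg
  exact hneg

omit [MeasurableSpace α] [MeasurableSingletonClass α] in
lemma sum_fiber_mul_channel {V : Ω → β} (hV : Measurable V) {w : β → α → ℝ}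
    (hw1 : ∀ v, ∑ s, w v s = 1) : ∑ t : α × β, μ.real (V ⁻¹' {t.2}) * w t.2 t.1 = 1 := by
  rw [Fintype.sum_prod_type_right]
  simp only [← Finset.mul_sum, hw1, mul_one]
  exact sum_measureReal_fiber hV

lemma condInfo_le {S : Ω → α} {V : Ω → β} (hS : Measurable S) (hV : Measurable V)
    {w : β → α → ℝ} (hpos : ∀ᵐ ω ∂μ, 0 < w (V ω) (S ω)) (hw : ∀ v s, 0 ≤ w v s)
    (hw1 : ∀ v, ∑ s, w v s = 1) :
    condInfo μ S V ≤ ∫ ω, -Real.log (w (V ω) (S ω)) ∂μ := by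
  rw [← sub_nonneg, integral_sub_condInfo hS hV hpos]
  refine sum_mul_log_nonneg (fun _ => measureReal_nonneg)
    (fun t => mul_nonneg measureReal_nonneg (hw _ _)) (pos_of_measureReal_pos hpos) ?_
  rw [sum_fiber_mul_channel hV hw1, sum_measureReal_fiber (hS.prodMk hV)]

lemma sum_abs_sub_channel_le {S : Ω → α} {V : Ω → β} (hS : Measurable S) (hV : Measurable V)
    {w : β → α → ℝ} (hpos : ∀ᵐ ω ∂μ, 0 < w (V ω) (S ω)) (hw : ∀ v s, 0 ≤ w v s)
    (hw1 : ∀ v, ∑ s, w v s = 1) {ε : ℝ} (hε : 0 < ε) :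
    ∑ t : α × β, |μ.real ((fun ω => (S ω, V ω)) ⁻¹' {t}) - μ.real (V ⁻¹' {t.2}) * w t.2 t.1| ≤
      (∫ ω, -Real.log (w (V ω) (S ω)) ∂μ - condInfo μ S V) / (2 * ε) + 2 * ε := by
  rw [integral_sub_condInfo hS hV hpos]
  exact sum_abs_sub_le (fun _ => measureReal_nonneg)
    (fun t => mul_nonneg measureReal_nonneg (hw _ _)) (pos_of_measureReal_pos hpos)
    (sum_measureReal_fiber (hS.prodMk hV)) (sum_fiber_mul_channel hV hw1) hε

end CondInfo

/-! ### Blocks of one-sided processes -/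

section Blocks

variable {Ω α β : Type*}

/-- The block `(Uₐ, …, Uₐ₊ₘ₋₁)` of a one-sided process. -/
def seqBlock (U : ℕ → Ω → α) (a m : ℕ) (ω : Ω) : Fin m → α := fun j => U (a + j) ω

lemma seqBlock_eq_iff (U : ℕ → Ω → α) (a m : ℕ) (ω ω' : Ω) :
    seqBlock U a m ω = seqBlock U a m ω' ↔ ∀ j < m, U (a + j) ω = U (a + j) ω' := by
  simp [seqBlock, funext_iff, Fin.forall_iff]

lemma seqBlock_add_eq_iff (U : ℕ → Ω → α) (a m m' : ℕ) (ω ω' : Ω) :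
    seqBlock U a (m + m') ω = seqBlock U a (m + m') ω' ↔
      seqBlock U a m ω = seqBlock U a m ω' ∧
        seqBlock U (a + m) m' ω = seqBlock U (a + m) m' ω' := by
  simp only [seqBlock_eq_iff]
  refine ⟨fun h => ⟨fun j hj => h j (by omega), fun j hj => ?_⟩, fun ⟨h, h'⟩ j hj => ?_⟩
  · simpa [add_assoc] using h (m + j) (by omega)
  · by_cases hjm : j < m
    · exact h j hjm
    · obtain ⟨i, rfl⟩ := Nat.exists_eq_add_of_le (not_lt.1 hjm)
      simpa [add_assoc] using h' i (by omega)

variable [MeasurableSpace Ω] {μ : Measure Ω}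

lemma measurable_seqBlock [MeasurableSpace α] {U : ℕ → Ω → α} (hU : ∀ i, Measurable (U i))
    (a m : ℕ) : Measurable (seqBlock U a m) :=
  measurable_pi_lambda _ fun _ => hU _

lemma condInfo_congr {α' β' : Type*} {S : Ω → α} {V : Ω → β} {S' : Ω → α'} {V' : Ω → β'}
    (hS : ∀ ω ω', S ω = S ω' ↔ S' ω = S' ω') (hV : ∀ ω ω', V ω = V ω' ↔ V' ω = V' ω') :
    condInfo μ S V = condInfo μ S' V' := by
  unfold condInfo
  refine integral_congr_ae (Eventually.of_forall fun ω => ?_)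
  dsimp only
  rw [atomProb_congr hV, atomProb_congr (U := fun ω => (S ω, V ω)) (U' := fun ω => (S' ω, V' ω))]
  simp [hS, hV]

variable [IsProbabilityMeasure μ]
  [Fintype α] [MeasurableSpace α] [MeasurableSingletonClass α]
  [Fintype β] [MeasurableSpace β] [MeasurableSingletonClass β]

lemma condInfo_seqBlock_add_le {U : ℕ → Ω → β} {V : ℕ → Ω → α} (hU : ∀ i, Measurable (U i))
    (hV : ∀ i, Measurable (V i)) (a m m' : ℕ) :
    condInfo μ (seqBlock U a (m + m')) (seqBlock V a (m + m')) ≤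
      condInfo μ (seqBlock U a m) (seqBlock V a m) +
        condInfo μ (seqBlock U (a + m) m') (seqBlock V (a + m) m') := by
  refine le_of_eq_of_le (condInfo_congr ?_ ?_)
    (condInfo_pair_le (measurable_seqBlock hU a m) (measurable_seqBlock hU (a + m) m')
      (measurable_seqBlock hV a m) (measurable_seqBlock hV (a + m) m'))
  · simp [seqBlock_add_eq_iff]
  · simp [seqBlock_add_eq_iff]

/-- The transition probabilities of the memoryless channel on blocks. -/
def blockChannel (W : Matrix α β ℝ) {m : ℕ} (y : Fin m → α) (z : Fin m → β) : ℝ :=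
  ∏ j, W (y j) (z j)

omit [Fintype α] [MeasurableSpace α] [MeasurableSingletonClass α]
  [MeasurableSpace β] [MeasurableSingletonClass β] in
lemma IsChannel.blockChannel {W : Matrix α β ℝ} (hW : IsChannel W) (m : ℕ) :
    IsChannel (Matrix.of (blockChannel W (m := m))) where
  nonneg y z := show 0 ≤ ∏ j, W (y j) (z j) from Finset.prod_nonneg fun _ _ => hW.nonneg _ _
  sum_eq_one y := by
    have h := Finset.prod_univ_sum (fun _ : Fin m => (Finset.univ : Finset β))
      fun j z => W (y j) z
    simp only [hW.sum_eq_one, Finset.prod_const_one, Fintype.piFinset_univ] at h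
    exact h.symm

/-- The divergence of the law of a block of `(U, V)` from the law of the corresponding block
of `V` followed by the channel `W`. -/
noncomputable def channelGap (μ : Measure Ω) (W : Matrix α β ℝ) (U : ℕ → Ω → β) (V : ℕ → Ω → α)
    (a m : ℕ) : ℝ :=
  ∫ ω, -Real.log (blockChannel W (seqBlock V a m ω) (seqBlock U a m ω)) ∂μ -
    condInfo μ (seqBlock U a m) (seqBlock V a m)

variable {W : Matrix α β ℝ} {U : ℕ → Ω → β} {V : ℕ → Ω → α}

omit [IsProbabilityMeasure μ] [Fintype α] [MeasurableSpace α] [MeasurableSingletonClass α]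
  [Fintype β] [MeasurableSpace β] [MeasurableSingletonClass β] in
lemma ae_blockChannel_pos (hpos : ∀ᵐ ω ∂μ, ∀ i, 0 < W (V i ω) (U i ω)) (a m : ℕ) :
    ∀ᵐ ω ∂μ, 0 < blockChannel W (seqBlock V a m ω) (seqBlock U a m ω) := by
  filter_upwards [hpos] with ω hω
  exact Finset.prod_pos fun j _ => hω _

lemma channelGap_nonneg (hW : IsChannel W) (hU : ∀ i, Measurable (U i))
    (hV : ∀ i, Measurable (V i)) (hpos : ∀ᵐ ω ∂μ, ∀ i, 0 < W (V i ω) (U i ω)) (a m : ℕ) :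
    0 ≤ channelGap μ W U V a m :=
  sub_nonneg.2 (condInfo_le (w := blockChannel W) (measurable_seqBlock hU a m)
    (measurable_seqBlock hV a m) (ae_blockChannel_pos hpos a m) (hW.blockChannel m).nonneg
    (hW.blockChannel m).sum_eq_one)

lemma integrable_log_blockChannel (hU : ∀ i, Measurable (U i))
    (hV : ∀ i, Measurable (V i)) (a m : ℕ) :
    Integrable (fun ω => -Real.log (blockChannel W (seqBlock V a m ω) (seqBlock U a m ω))) μ :=
  integrable_comp_fintype ((measurable_seqBlock hV a m).prodMk (measurable_seqBlock hU a m))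
    fun t => -Real.log (blockChannel W t.1 t.2)

/-- The log-likelihood is additive over adjacent blocks because the channel is memoryless, while the
conditional entropy subtracted from it is subadditive. -/
lemma channelGap_add_le (hU : ∀ i, Measurable (U i))
    (hV : ∀ i, Measurable (V i)) (hpos : ∀ᵐ ω ∂μ, ∀ i, 0 < W (V i ω) (U i ω)) (a m m' : ℕ) :
    channelGap μ W U V a m + channelGap μ W U V (a + m) m' ≤ channelGap μ W U V a (m + m') := by
  have h : ∫ ω, -Real.log (blockChannel W (seqBlock V a (m + m') ω) (seqBlock U a (m + m') ω)) ∂μ =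
      ∫ ω, -Real.log (blockChannel W (seqBlock V a m ω) (seqBlock U a m ω)) ∂μ +
        ∫ ω, -Real.log (blockChannel W (seqBlock V (a + m) m' ω) (seqBlock U (a + m) m' ω)) ∂μ := by
    rw [← integral_add (integrable_log_blockChannel hU hV a m)
      (integrable_log_blockChannel hU hV (a + m) m')]
    refine integral_congr_ae ?_
    filter_upwards [hpos] with ω hω
    have h1 : blockChannel W (seqBlock V a (m + m') ω) (seqBlock U a (m + m') ω) =
        blockChannel W (seqBlock V a m ω) (seqBlock U a m ω) *
          blockChannel W (seqBlock V (a + m) m' ω) (seqBlock U (a + m) m' ω) := by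
      simp [blockChannel, seqBlock, Fin.prod_univ_add, add_assoc]
    rw [h1, Real.log_mul]
    · ring
    · exact (Finset.prod_pos fun j _ => hω _).ne'
    · exact (Finset.prod_pos fun j _ => hω _).ne'
  have := condInfo_seqBlock_add_le (μ := μ) hU hV a m m'
  unfold channelGap
  linarith

/-- With `D t` the gap of the first `t` letters, superadditivity bounds the gap of a window by an
increment of `D`. The increments telescope up to `m + 1` boundary terms, each at most `D (M + m)` by
monotonicity. -/
lemma sum_channelGap_le (hW : IsChannel W) (hU : ∀ i, Measurable (U i))
    (hV : ∀ i, Measurable (V i)) (hpos : ∀ᵐ ω ∂μ, ∀ i, 0 < W (V i ω) (U i ω)) (M m : ℕ) :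
    ∑ i ∈ Finset.range M, channelGap μ W U V i (m + 1) ≤
      (m + 1) * channelGap μ W U V 0 (M + m) := by
  set D : ℕ → ℝ := channelGap μ W U V 0 with hD
  have h1 : ∀ i s, channelGap μ W U V i s ≤ D (i + s) - D i := fun i s => by
    have := channelGap_add_le hU hV hpos 0 i s
    rw [zero_add] at this
    linarith
  have hmono : ∀ t s, D t ≤ D (t + s) := fun t s => by
    linarith [h1 t s, channelGap_nonneg hW hU hV hpos t s]
  -- The sum of `D` below `M + m + 1` is split once at `M` and once at `m + 1`.
  have h2 := (Finset.sum_range_add D M (m + 1)).symm.trans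
    ((congrArg (fun t => ∑ i ∈ Finset.range t, D i) (add_comm M (m + 1))).trans
      (Finset.sum_range_add D (m + 1) M))
  have h3 : ∑ j ∈ Finset.range (m + 1), D (M + j) ≤ (m + 1) * D (M + m) := by
    refine (Finset.sum_le_card_nsmul _ _ (D (M + m)) fun j hj => ?_).trans_eq (by simp)
    obtain ⟨s, hs⟩ := Nat.exists_eq_add_of_le (Nat.lt_succ_iff.1 (Finset.mem_range.1 hj))
    have := hmono (M + j) s
    rwa [add_assoc, ← hs] at this
  have h4 : 0 ≤ ∑ j ∈ Finset.range (m + 1), D j :=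
    Finset.sum_nonneg fun j _ => channelGap_nonneg hW hU hV hpos 0 j
  calc ∑ i ∈ Finset.range M, channelGap μ W U V i (m + 1)
      ≤ ∑ i ∈ Finset.range M, (D (i + (m + 1)) - D i) := Finset.sum_le_sum fun i _ => h1 i (m + 1)
    _ = ∑ i ∈ Finset.range M, D (m + 1 + i) - ∑ i ∈ Finset.range M, D i := by
        rw [Finset.sum_sub_distrib]; simp [add_comm]
    _ ≤ (m + 1) * D (M + m) := by linarith

/-- Here the mutual information is bounded by the entropy of the reconstruction: `H(U|V) = H(U, V) -
H(V)` and `H(U, V) ≥ H(U)`. -/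
lemma channelGap_le (hU : ∀ i, Measurable (U i)) (hV : ∀ i, Measurable (V i)) (a m : ℕ) :
    channelGap μ W U V a m ≤
      ∫ ω, -Real.log (blockChannel W (seqBlock V a m ω) (seqBlock U a m ω)) ∂μ -
        entropy μ (seqBlock U a m) + entropy μ (seqBlock V a m) := by
  have hSU := measurable_seqBlock hU a m
  have hSV := measurable_seqBlock hV a m
  have h : ∫ ω, Real.log (atomProb μ (fun ω => (seqBlock U a m ω, seqBlock V a m ω)) ω) ∂μ ≤
      ∫ ω, Real.log (atomProb μ (seqBlock U a m) ω) ∂μ := by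
    refine integral_mono_ae (integrable_log_atomProb (hSU.prodMk hSV))
      (integrable_log_atomProb hSU) ?_
    filter_upwards [ae_atomProb_pos (μ := μ) (hSU.prodMk hSV)] with ω hω
    exact Real.log_le_log hω (atomProb_pair_le_left _ _ ω)
  rw [channelGap, condInfo_eq hSU hSV]
  rw [integral_log_atomProb hSU] at h
  rw [integral_log_atomProb hSV]
  linarith

end Blocks

/-! ### The distortion matched to a channel -/

section Distortion

variable {α β : Type*} [Fintype α] [Fintype β] {W : Matrix α β ℝ} {n : ℕ}

omit [Fintype α] in
lemma IsChannel.le_one (hW : IsChannel W) (x : α) (z : β) : W x z ≤ 1 := by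
  rw [← hW.sum_eq_one x]
  exact Finset.single_le_sum (fun z _ => hW.nonneg x z) (Finset.mem_univ z)

omit [Fintype α] in
lemma blockDistortion_of_pos (hW : IsChannel W) {z : Fin n → β} {y : Fin n → α}
    (h : 0 < blockChannel W y z) :
    blockDistortion (channelDistortion W) z y =
      ENNReal.ofReal (-Real.log (blockChannel W y z) / n) := by
  have hne : ∀ i, W (y i) (z i) ≠ 0 := fun i =>
    Finset.prod_ne_zero_iff.1 h.ne' i (Finset.mem_univ i)
  have h1 : ∀ i, channelDistortion W (z i) (y i) = ENNReal.ofReal (-Real.log (W (y i) (z i))) :=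
    fun i => by simp [channelDistortion, hne i]
  have h2 : ∀ i, 0 ≤ -Real.log (W (y i) (z i)) := fun i =>
    neg_nonneg.2 (Real.log_nonpos (hW.nonneg _ _) (hW.le_one _ _))
  rcases n.eq_zero_or_pos with rfl | hn
  · simp [blockDistortion]
  · rw [blockDistortion, Finset.sum_congr rfl fun i _ => h1 i,
      ← ENNReal.ofReal_sum_of_nonneg fun i _ => h2 i, ENNReal.ofReal_div_of_pos (by positivity),
      ENNReal.ofReal_natCast, blockChannel, Real.log_prod fun i _ => hne i,
      Finset.sum_neg_distrib]

omit [Fintype α] in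
lemma blockDistortion_of_not_pos (hW : IsChannel W) {z : Fin n → β} {y : Fin n → α}
    (h : ¬ 0 < blockChannel W y z) : blockDistortion (channelDistortion W) z y = ⊤ := by
  have h0 : blockChannel W y z = 0 :=
    le_antisymm (not_lt.1 h) ((hW.blockChannel n).nonneg y z)
  obtain ⟨i, _, hi⟩ := Finset.prod_eq_zero_iff.1 h0
  rw [blockDistortion, ENNReal.div_eq_top]
  right
  exact ⟨ENNReal.sum_eq_top.2 ⟨i, Finset.mem_univ i, by simp [channelDistortion, hi]⟩, by simp⟩

end Distortion

/-! ### Stationarity and the law of the channel output -/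

section Stationary

variable {Ω α β γ : Type*} [MeasurableSpace Ω] {μ : Measure Ω}

lemma iterate_shift (N : ℕ) (s : ℤ → γ) : shift^[N] s = fun i => s (i + N) := by
  induction N with
  | zero => simp
  | succ N ih =>
    rw [Function.iterate_succ_apply', ih]
    funext i
    simp only [shift]
    congr 1
    push_cast
    ring

lemma measurable_path [MeasurableSpace γ] {P : ℤ → Ω → γ} (hP : ∀ i, Measurable (P i)) :
    Measurable (path P) :=
  measurable_pi_lambda _ fun i => hP i

lemma IsStationary.map_shift [MeasurableSpace γ] {P : ℤ → Ω → γ} (h : IsStationary μ P)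
    (hP : ∀ i, Measurable (P i)) (N : ℕ) :
    μ.map (path fun i => P (i + N)) = μ.map (path P) := by
  have h1 := (h.iterate N).map_eq
  rw [Measure.map_map (h.iterate N).measurable (measurable_path hP)] at h1
  rw [← h1]
  congr 1
  funext ω
  exact (iterate_shift N (path P ω)).symm

/-- The process `(P₁, P₂, …)` indexed from `0`. -/
def positivePart (P : ℤ → Ω → γ) : ℕ → Ω → γ := fun i => P (i + 1)

omit [MeasurableSpace Ω] in
lemma seqBlock_positivePart_zero (P : ℤ → Ω → γ) (n : ℕ) :
    seqBlock (positivePart P) 0 n = block P n := by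
  funext ω j
  simp [seqBlock, positivePart, block]

lemma IsStationary.map_seqBlock [MeasurableSpace γ] {P : ℤ → Ω → γ} (h : IsStationary μ P)
    (hP : ∀ i, Measurable (P i)) (a m : ℕ) :
    μ.map (seqBlock (positivePart P) a m) = μ.map (block P m) := by
  have hF : Measurable fun (s : ℤ → γ) (j : Fin m) => s (j + 1) := by fun_prop
  have h1 := congrArg (Measure.map fun (s : ℤ → γ) (j : Fin m) => s (j + 1)) (h.map_shift hP a)
  rw [Measure.map_map hF (measurable_path fun i => hP _),
    Measure.map_map hF (measurable_path hP)] at h1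
  convert h1 using 2
  · funext ω j
    simp only [seqBlock, positivePart, path, Function.comp]
    congr 1
    push_cast
    ring
  · rfl

lemma IsStationary.snd [MeasurableSpace α] [MeasurableSpace β] {X : ℤ → Ω → α} {Z : ℤ → Ω → β}
    (h : IsStationary μ fun i ω => (X i ω, Z i ω)) (hX : ∀ i, Measurable (X i))
    (hZ : ∀ i, Measurable (Z i)) : IsStationary μ Z := by
  have hP := fun i => (hX i).prodMk (hZ i)
  have hF : Measurable fun (s : ℤ → α × β) i => (s i).2 := by fun_prop
  have hs : ∀ γ : Type _, ∀ [MeasurableSpace γ], Measurable (shift : (ℤ → γ) → ℤ → γ) :=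
    fun γ _ => measurable_pi_lambda _ fun i => measurable_pi_apply _
  refine ⟨hs _, ?_⟩
  have h1 := congrArg (Measure.map fun (s : ℤ → α × β) i => (s i).2) h.map_eq
  rw [Measure.map_map hF h.measurable, Measure.map_map (hF.comp h.measurable) (measurable_path hP),
    Measure.map_map hF (measurable_path hP)] at h1
  rw [Measure.map_map (hs _) (measurable_path hZ)]
  exact h1

end Stationary

/-! ### Existence of the entropy rate -/

section EntropyRate

variable {Ω β : Type*} [MeasurableSpace Ω] {μ : Measure Ω} [IsProbabilityMeasure μ]
  [Fintype β] [MeasurableSpace β] [MeasurableSingletonClass β] {Z : ℤ → Ω → β}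

omit [IsProbabilityMeasure μ] in
lemma entropy_congr_map {S S' : Ω → β} (hS : Measurable S) (hS' : Measurable S')
    (h : μ.map S = μ.map S') : entropy μ S = entropy μ S' := by
  unfold entropy
  refine Finset.sum_congr rfl fun u _ => ?_
  rw [← map_measureReal_apply hS (measurableSet_singleton u), h,
    map_measureReal_apply hS' (measurableSet_singleton u)]

lemma measurable_block {γ : Type*} [MeasurableSpace γ] {P : ℤ → Ω → γ}
    (hP : ∀ i, Measurable (P i)) (n : ℕ) : Measurable (block P n) :=
  measurable_pi_lambda _ fun _ => hP _

omit [MeasurableSpace β] [MeasurableSingletonClass β] in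
lemma entropy_nonneg (S : Ω → β) : 0 ≤ entropy μ S :=
  Finset.sum_nonneg fun _ _ => Real.negMulLog_nonneg measureReal_nonneg measureReal_le_one

lemma condInfo_const {S : Ω → β} (hS : Measurable S) {γ : Type*} (c : γ) :
    condInfo μ S (fun _ => c) = entropy μ S := by
  rw [← neg_neg (entropy μ S), ← integral_log_atomProb hS, ← integral_neg]
  unfold condInfo
  refine integral_congr_ae (Eventually.of_forall fun ω => ?_)
  dsimp only
  rw [atomProb_congr (U := fun ω => (S ω, c)) (U' := S) (by simp)]
  simp [atomProb]

lemma subadditive_entropy_block (hZ : ∀ i, Measurable (Z i)) (h : IsStationary μ Z) :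
    Subadditive fun n => entropy μ (block Z n) := by
  intro m n
  -- Conditioning on a constant process turns the conditional inequality into the unconditional one.
  have h1 := condInfo_seqBlock_add_le (μ := μ) (U := positivePart Z) (V := fun _ _ => ())
    (fun i => hZ _) (fun i => measurable_const) 0 m n
  have h2 : ∀ a m, condInfo μ (seqBlock (positivePart Z) a m)
      (seqBlock (fun _ _ => ()) a m) = entropy μ (block Z m) := fun a m =>
    (condInfo_const (measurable_seqBlock (fun i => hZ _) a m) _).trans
      (entropy_congr_map (measurable_seqBlock (fun i => hZ _) a m) (measurable_block hZ m)
        (h.map_seqBlock hZ a m))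
  rwa [h2, h2, h2] at h1

/-- The entropy rate of a stationary process exists. -/
lemma exists_tendsto_entropy_block (hZ : ∀ i, Measurable (Z i)) (h : IsStationary μ Z) :
    ∃ l : ℝ, Tendsto (fun n : ℕ => entropy μ (block Z n) / n) atTop (𝓝 l) :=
  ⟨_, (subadditive_entropy_block hZ h).tendsto_lim
    ⟨0, by rintro _ ⟨n, rfl⟩; exact div_nonneg (entropy_nonneg _) (Nat.cast_nonneg n)⟩⟩

end EntropyRate

/-! ### Joint law and log-likelihood of the channel input and output -/

section Output

lemma measureReal_cond {Ω : Type*} [MeasurableSpace Ω] {μ : Measure Ω} {s : Set Ω}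
    (hs : MeasurableSet s) (t : Set Ω) :
    (cond μ s).real t = (μ.real s)⁻¹ * μ.real (s ∩ t) := by
  simp [measureReal_def, cond_apply hs, ENNReal.toReal_mul, ENNReal.toReal_inv]

variable {Ω α β : Type*} [MeasurableSpace Ω] {μ : Measure Ω} {X : ℤ → Ω → α} {Z : ℤ → Ω → β}
  {W : Matrix α β ℝ}

lemma IsMemorylessOutput.measureReal_single (h : IsMemorylessOutput μ X Z W) (i : ℤ) (x : α)
    (z : β) : μ.real ((fun ω => (X i ω, Z i ω)) ⁻¹' {(x, z)}) =
      μ.real (X i ⁻¹' {x}) * W x z := by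
  have := h {i} (fun _ => x) (fun _ => z)
  simp only [Finset.mem_singleton, forall_eq, Finset.prod_singleton] at this
  convert this using 2
  · ext ω
    simp
  · rfl

lemma IsMemorylessOutput.measureReal_block [Nonempty α] [Nonempty β]
    (h : IsMemorylessOutput μ X Z W) {m : ℕ} (x : Fin m → α) (z : Fin m → β) :
    μ.real ((fun ω => (block Z m ω, block X m ω)) ⁻¹' {(z, x)}) =
      μ.real (block X m ⁻¹' {x}) * blockChannel W x z := by
  let e : Fin m ↪ ℤ := ⟨fun j => (j : ℤ) + 1, fun i j hij => by
    simp only [add_left_inj, Nat.cast_inj] at hij; exact Fin.ext hij⟩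
  -- The values assigned outside the times `1, …, m` are irrelevant.
  have := h (Finset.univ.map e) (Function.extend e x fun _ => Classical.arbitrary α)
    (Function.extend e z fun _ => Classical.arbitrary β)
  simp only [Finset.mem_map, Finset.mem_univ, true_and, forall_exists_index,
    forall_apply_eq_imp_iff, Finset.prod_map, e.injective.extend_apply] at this
  convert this using 2
  · ext ω
    simp only [Set.mem_preimage, Set.mem_singleton_iff, Prod.mk.injEq, funext_iff,
      Set.mem_ofPred_eq, forall_and]
    exact and_comm
  · congr 1
    ext ω
    simp only [Set.mem_preimage, Set.mem_singleton_iff, funext_iff, Set.mem_ofPred_eq]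
    rfl
  · rfl

variable [IsProbabilityMeasure μ]
  [Fintype α] [MeasurableSpace α] [MeasurableSingletonClass α]
  [Fintype β] [MeasurableSpace β] [MeasurableSingletonClass β]

lemma IsMemorylessOutput.ae_pos (h : IsMemorylessOutput μ X Z W)
    (hX : ∀ i, Measurable (X i)) (hZ : ∀ i, Measurable (Z i)) :
    ∀ᵐ ω ∂μ, ∀ i, 0 < W (X i ω) (Z i ω) := by
  refine ae_all_iff.2 fun i => ?_
  filter_upwards [ae_atomProb_pos (μ := μ) ((hX i).prodMk (hZ i))] with ω hω
  unfold atomProb at hω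
  rw [h.measureReal_single] at hω
  exact pos_of_mul_pos_right hω measureReal_nonneg

/-- The conditional entropy of the output given the input at a fixed time. -/
lemma IsMemorylessOutput.condEntropy_eq (h : IsMemorylessOutput μ X Z W)
    (hX : ∀ i, Measurable (X i)) (hZ : ∀ i, Measurable (Z i)) (i : ℤ) :
    condEntropy μ (Z i) (X i) = ∫ ω, -Real.log (W (X i ω) (Z i ω)) ∂μ := by
  rw [integral_comp_fintype ((hX i).prodMk (hZ i)) fun t => -Real.log (W t.1 t.2),
    Fintype.sum_prod_type, condEntropy]
  refine Finset.sum_congr rfl fun x _ => ?_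
  simp only [h.measureReal_single, mul_assoc, ← Finset.mul_sum]
  rcases (measureReal_nonneg (μ := μ) (s := X i ⁻¹' {x})).eq_or_lt with h0 | h0
  · simp [← h0]
  congr 1
  rw [entropy]
  refine Finset.sum_congr rfl fun z _ => ?_
  have : (cond μ (X i ⁻¹' {x})).real (Z i ⁻¹' {z}) = W x z := by
    rw [measureReal_cond (hX i (measurableSet_singleton x))]
    have := h.measureReal_single i x z
    have h2 : (fun ω => (X i ω, Z i ω)) ⁻¹' {(x, z)} = X i ⁻¹' {x} ∩ Z i ⁻¹' {z} := by
      ext; simp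
    rw [h2] at this
    rw [this, inv_mul_cancel_left₀ h0.ne']
  rw [this, Real.negMulLog]
  ring

omit [IsProbabilityMeasure μ] in
lemma IsStationary.integral_single {P : ℤ → Ω → α} (h : IsStationary μ P)
    (hP : ∀ i, Measurable (P i)) (f : α → ℝ) (N : ℕ) :
    ∫ ω, f (P N ω) ∂μ = ∫ ω, f (P 0 ω) ∂μ := by
  have hf : Measurable fun s : ℤ → α => f (s 0) :=
    (measurable_of_finite f).comp (measurable_pi_apply 0)
  have h1 : ∫ s, f (s 0) ∂(μ.map (path fun i => P (i + N))) = ∫ s, f (s 0) ∂(μ.map (path P)) := by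
    rw [h.map_shift hP N]
  rw [integral_map (measurable_path fun i => hP _).aemeasurable hf.aestronglyMeasurable,
    integral_map (measurable_path hP).aemeasurable hf.aestronglyMeasurable] at h1
  simpa [path] using h1

/-- The true input meets the distortion constraint at level `H(Z₀|X₀)` with equality. -/
lemma IsMemorylessOutput.integral_log_blockChannel (h : IsMemorylessOutput μ X Z W)
    (hX : ∀ i, Measurable (X i)) (hZ : ∀ i, Measurable (Z i))
    (hst : IsStationary μ fun i ω => (X i ω, Z i ω)) (k : ℕ) :
    ∫ ω, -Real.log (blockChannel W (block X k ω) (block Z k ω)) ∂μ =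
      k * condEntropy μ (Z 0) (X 0) := by
  have h1 : ∀ᵐ ω ∂μ, -Real.log (blockChannel W (block X k ω) (block Z k ω)) =
      ∑ j : Fin k, -Real.log (W (X ((j : ℤ) + 1) ω) (Z ((j : ℤ) + 1) ω)) := by
    filter_upwards [h.ae_pos hX hZ] with ω hω
    rw [Finset.sum_neg_distrib, ← Real.log_prod fun i _ => (hω _).ne']
    rfl
  rw [integral_congr_ae h1, integral_finsetSum]
  · have h2 : ∀ j : Fin k, ∫ ω, -Real.log (W (X ((j : ℤ) + 1) ω) (Z ((j : ℤ) + 1) ω)) ∂μ =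
        condEntropy μ (Z 0) (X 0) := fun j => by
      rw [h.condEntropy_eq hX hZ]
      exact_mod_cast hst.integral_single (fun i => (hX i).prodMk (hZ i))
        (fun t => -Real.log (W t.1 t.2)) (j + 1)
    simp [h2]
  · exact fun j _ => integrable_comp_fintype ((hX _).prodMk (hZ _)) fun t => -Real.log (W t.1 t.2)

end Output

/-! ### The rate-distortion function of the channel output -/

section MutualInfo

variable {σ τ : Type*} [Fintype σ] [Fintype τ] {J : σ → τ → ℝ} {w : τ → σ → ℝ}

/-- The last sum is the divergence of `J` from its second marginal sent through `w`. Its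
nonnegativity gives the Shannon lower bound, and it vanishes when `w` is the backward channel of
`J`. -/
lemma mutualInfo_eq (hJ : ∀ z y, 0 ≤ J z y) (hw : ∀ z y, 0 < J z y → 0 < w y z) :
    mutualInfo J = ∑ z, Real.negMulLog (∑ y, J z y) + ∑ z, ∑ y, J z y * Real.log (w y z) +
      ∑ z, ∑ y, J z y * (Real.log (J z y) - Real.log ((∑ z', J z' y) * w y z)) := by
  rw [mutualInfo, ← Finset.sum_add_distrib, ← Finset.sum_add_distrib]
  refine Finset.sum_congr rfl fun z _ => ?_
  rw [Real.negMulLog, ← Finset.sum_neg_distrib, Finset.sum_mul, ← Finset.sum_add_distrib,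
    ← Finset.sum_add_distrib]
  refine Finset.sum_congr rfl fun y _ => ?_
  rcases (hJ z y).eq_or_lt with h0 | h0
  · simp [← h0]
  have h1 : 0 < ∑ y', J z y' :=
    h0.trans_le (Finset.single_le_sum (fun y _ => hJ z y) (Finset.mem_univ y))
  have h2 : 0 < ∑ z', J z' y :=
    h0.trans_le (Finset.single_le_sum (f := fun z => J z y) (fun z _ => hJ z y)
      (Finset.mem_univ z))
  rw [Real.log_div h0.ne' (by positivity), Real.log_mul h1.ne' h2.ne',
    Real.log_mul h2.ne' (hw z y h0).ne']
  ring

lemma le_mutualInfo (hJ : ∀ z y, 0 ≤ J z y) (hw : ∀ z y, 0 < J z y → 0 < w y z)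
    (hw0 : ∀ y z, 0 ≤ w y z) (hw1 : ∀ y, ∑ z, w y z = 1) :
    ∑ z, Real.negMulLog (∑ y, J z y) + ∑ z, ∑ y, J z y * Real.log (w y z) ≤ mutualInfo J := by
  rw [mutualInfo_eq hJ hw, le_add_iff_nonneg_right]
  have h := sum_mul_log_nonneg (p := fun t : σ × τ => J t.1 t.2)
    (q := fun t => (∑ z', J z' t.2) * w t.2 t.1) (fun _ => hJ _ _)
    (fun t => mul_nonneg (Finset.sum_nonneg fun _ _ => hJ _ _) (hw0 _ _))
    (fun t ht => mul_pos (ht.trans_le (Finset.single_le_sum (f := fun z => J z t.2)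
      (fun z _ => hJ z _) (Finset.mem_univ t.1))) (hw _ _ ht)) ?_
  · rwa [Fintype.sum_prod_type] at h
  · rw [Fintype.sum_prod_type_right, Fintype.sum_prod_type_right]
    simp [← Finset.mul_sum, hw1]

lemma mutualInfo_eq_of_channel {r : τ → ℝ} (hr : ∀ y, 0 ≤ r y)
    (hw0 : ∀ y z, 0 ≤ w y z) (hw1 : ∀ y, ∑ z, w y z = 1) (hJ : ∀ z y, J z y = r y * w y z) :
    mutualInfo J = ∑ z, Real.negMulLog (∑ y, J z y) + ∑ z, ∑ y, J z y * Real.log (w y z) := by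
  have hJ0 : ∀ z y, 0 ≤ J z y := fun z y => by rw [hJ]; exact mul_nonneg (hr y) (hw0 y z)
  rw [mutualInfo_eq (w := w) hJ0 fun z y h => by
    rw [hJ] at h; exact pos_of_mul_pos_right h (hr y)]
  simp [hJ, ← Finset.mul_sum, hw1]

end MutualInfo

section RateDistortion

variable {Ω α β : Type*} [MeasurableSpace Ω] {μ : Measure Ω} [IsProbabilityMeasure μ]
  [Fintype α] [Nonempty α] [MeasurableSpace α] [MeasurableSingletonClass α]
  [Fintype β] [MeasurableSpace β] [MeasurableSingletonClass β]
  {X : ℤ → Ω → α} {Z : ℤ → Ω → β} {W : Matrix α β ℝ}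

omit [IsProbabilityMeasure μ] [Nonempty α] [MeasurableSpace α] [MeasurableSingletonClass α]
  [MeasurableSpace β] [MeasurableSingletonClass β] in
lemma condEntropy_nonneg (S : Ω → α) (V : Ω → β) : 0 ≤ condEntropy μ S V := by
  refine Finset.sum_nonneg fun v _ => mul_nonneg measureReal_nonneg ?_
  exact Finset.sum_nonneg fun u _ => Real.negMulLog_nonneg measureReal_nonneg measureReal_le_one

omit [Fintype α] [Nonempty α] [MeasurableSpace α] [MeasurableSingletonClass α]
  [MeasurableSpace β] [MeasurableSingletonClass β] in
lemma sum_mul_blockDistortion [Fintype α] (hW : IsChannel W) {k : ℕ}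
    {J : (Fin k → β) → (Fin k → α) → ℝ} (hJ0 : ∀ z y, 0 ≤ J z y)
    (hw : ∀ z y, 0 < J z y → 0 < blockChannel W y z) :
    ∑ z, ∑ y, ENNReal.ofReal (J z y) * blockDistortion (channelDistortion W) z y =
      ENNReal.ofReal (-(∑ z, ∑ y, J z y * Real.log (blockChannel W y z)) / k) := by
  have h3 : ∀ z y, ENNReal.ofReal (J z y) *
      blockDistortion (channelDistortion W) z y = ENNReal.ofReal
        (J z y * (-Real.log (blockChannel W y z) / k)) := by
    intro z y
    rcases (hJ0 z y).eq_or_lt with h0 | h0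
    · simp [← h0]
    · rw [blockDistortion_of_pos hW (hw z y h0), ENNReal.ofReal_mul h0.le]
  have h4 : ∀ z y, 0 ≤ J z y * (-Real.log (blockChannel W y z) / k) := fun z y =>
    mul_nonneg (hJ0 z y) (div_nonneg (neg_nonneg.2 (Real.log_nonpos
      ((hW.blockChannel k).nonneg y z) ((hW.blockChannel k).le_one y z))) (Nat.cast_nonneg k))
  simp only [h3]
  rw [Finset.sum_congr rfl fun z _ => (ENNReal.ofReal_sum_of_nonneg fun y _ => h4 z y).symm,
    ← ENNReal.ofReal_sum_of_nonneg fun z _ => Finset.sum_nonneg fun y _ => h4 z y]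
  simp only [← Finset.sum_neg_distrib, Finset.sum_div]
  congr 1
  exact Finset.sum_congr rfl fun z _ => Finset.sum_congr rfl fun y _ => by ring

omit [IsProbabilityMeasure μ] [Nonempty α] [MeasurableSpace α] [MeasurableSingletonClass α]
  [MeasurableSpace β] [MeasurableSingletonClass β] in
-- The Shannon lower bound, with the log-likelihood term controlled by the distortion constraint.
lemma le_mutualInfo_of_distortion (hW : IsChannel W) {k : ℕ}
    (hk : 0 < k) {D : ℝ} (hD : 0 ≤ D) {V : Matrix (Fin k → β) (Fin k → α) ℝ} (hV : IsChannel V)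
    (h : ∑ z, ∑ y, ENNReal.ofReal (μ.real (block Z k ⁻¹' {z}) * V z y) *
      blockDistortion (channelDistortion W) z y ≤ ENNReal.ofReal D) :
    entropy μ (block Z k) - k * D ≤
      mutualInfo fun z y => μ.real (block Z k ⁻¹' {z}) * V z y := by
  have hJ0 : ∀ z y, 0 ≤ μ.real (block Z k ⁻¹' {z}) * V z y := fun z y =>
    mul_nonneg measureReal_nonneg (hV.nonneg z y)
  have hw : ∀ z y, 0 < μ.real (block Z k ⁻¹' {z}) * V z y → 0 < blockChannel W y z := by
    -- A pair of positive mass that the channel forbids would make the expected distortion infinite.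
    intro z y hzy
    by_contra hneg
    have h1 : ENNReal.ofReal (μ.real (block Z k ⁻¹' {z}) * V z y) *
        blockDistortion (channelDistortion W) z y ≤ ENNReal.ofReal D :=
      ((Finset.single_le_sum (f := fun y => ENNReal.ofReal (μ.real (block Z k ⁻¹' {z}) * V z y) *
        blockDistortion (channelDistortion W) z y) (fun _ _ => zero_le)
        (Finset.mem_univ y)).trans (Finset.single_le_sum
        (f := fun z => ∑ y, ENNReal.ofReal (μ.real (block Z k ⁻¹' {z}) * V z y) *
        blockDistortion (channelDistortion W) z y) (fun _ _ => zero_le)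
        (Finset.mem_univ z))).trans h
    rw [blockDistortion_of_not_pos hW hneg, ENNReal.mul_top (ENNReal.ofReal_pos.2 hzy).ne'] at h1
    exact ENNReal.ofReal_ne_top (top_le_iff.1 h1)
  have h2 := le_mutualInfo hJ0 hw (hW.blockChannel k).nonneg (hW.blockChannel k).sum_eq_one
  simp only [← Finset.mul_sum, hV.sum_eq_one, mul_one] at h2
  rw [sum_mul_blockDistortion hW hJ0 hw, ENNReal.ofReal_le_ofReal_iff hD] at h
  rw [div_le_iff₀ (by positivity)] at h
  unfold entropy
  linarith

/-- The witness is the posterior of `Xᵏ` given `Zᵏ`: its backward channel is the memoryless channel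
itself, so the Shannon lower bound is attained. -/
lemma exists_channel_mutualInfo_eq (hW : IsChannel W) (hX : ∀ i, Measurable (X i))
    (hZ : ∀ i, Measurable (Z i)) (hXZ : IsMemorylessOutput μ X Z W)
    (hst : IsStationary μ fun i ω => (X i ω, Z i ω)) {k : ℕ} (hk : 0 < k) :
    ∃ V : Matrix (Fin k → β) (Fin k → α) ℝ, IsChannel V ∧
      ∑ z, ∑ y, ENNReal.ofReal (μ.real (block Z k ⁻¹' {z}) * V z y) *
        blockDistortion (channelDistortion W) z y ≤
          ENNReal.ofReal (condEntropy μ (Z 0) (X 0)) ∧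
      mutualInfo (fun z y => μ.real (block Z k ⁻¹' {z}) * V z y) =
        entropy μ (block Z k) - k * condEntropy μ (Z 0) (X 0) := by
  classical
  have : Nonempty Ω := nonempty_of_isProbabilityMeasure μ
  have : Nonempty β := ⟨Z 0 (Classical.arbitrary Ω)⟩
  have hXk := measurable_block hX k
  have hZk := measurable_block hZ k
  let J : (Fin k → β) → (Fin k → α) → ℝ := fun z x =>
    μ.real ((fun ω => (block Z k ω, block X k ω)) ⁻¹' {(z, x)})
  have hJsum : ∀ z, ∑ x, J z x = μ.real (block Z k ⁻¹' {z}) := fun z => by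
    rw [← sum_measureReal_fiber_pair hXk]
    refine Finset.sum_congr rfl fun x _ => ?_
    simp only [J]
    congr 1
    ext ω
    simp [and_comm]
  -- At null outputs any probability vector serves; a point mass keeps `V` stochastic.
  let V : Matrix (Fin k → β) (Fin k → α) ℝ := fun z x =>
    if μ.real (block Z k ⁻¹' {z}) = 0 then (if x = Classical.arbitrary _ then 1 else 0)
    else J z x / μ.real (block Z k ⁻¹' {z})
  have hV : IsChannel V := by
    refine ⟨fun z x => ?_, fun z => ?_⟩
    · simp only [V, J]
      split_ifs <;> positivity
    · simp only [V]
      split_ifs with h0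
      · simp
      · rw [← Finset.sum_div, hJsum, div_self h0]
  have hVJ : ∀ z x, μ.real (block Z k ⁻¹' {z}) * V z x = J z x := by
    intro z x
    by_cases h0 : μ.real (block Z k ⁻¹' {z}) = 0
    · rw [h0, zero_mul]
      refine (le_antisymm ?_ measureReal_nonneg).symm
      rw [← h0, ← hJsum]
      exact Finset.single_le_sum (f := J z) (fun _ _ => measureReal_nonneg) (Finset.mem_univ x)
    · simp only [V, if_neg h0]
      field_simp
  have hJ : ∀ z x, J z x = μ.real (block X k ⁻¹' {x}) * blockChannel W x z := fun z x =>
    hXZ.measureReal_block x z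
  have hlog : ∑ z, ∑ x, J z x * Real.log (blockChannel W x z) =
      -(k * condEntropy μ (Z 0) (X 0)) := by
    rw [← hXZ.integral_log_blockChannel hX hZ hst k, ← integral_neg]
    simp only [neg_neg]
    rw [integral_comp_fintype (hZk.prodMk hXk) fun t => Real.log (blockChannel W t.2 t.1),
      Fintype.sum_prod_type]
  refine ⟨V, hV, ?_, ?_⟩
  · simp only [hVJ]
    rw [sum_mul_blockDistortion hW (fun _ _ => measureReal_nonneg) fun z x h => by
      change 0 < J z x at h; rw [hJ] at h; exact pos_of_mul_pos_right h measureReal_nonneg, hlog, neg_neg,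
      mul_div_cancel_left₀ _ (by positivity)]
  · simp only [hVJ]
    rw [mutualInfo_eq_of_channel (fun _ => measureReal_nonneg) (hW.blockChannel k).nonneg
      (hW.blockChannel k).sum_eq_one hJ]
    simp only [hJsum]
    rw [show ∑ z, ∑ y, J z y * Real.log ((Matrix.of (blockChannel W)) y z) = _ from hlog]
    rfl

lemma blockRateDistortion_eq (hW : IsChannel W) (hX : ∀ i, Measurable (X i))
    (hZ : ∀ i, Measurable (Z i)) (hXZ : IsMemorylessOutput μ X Z W)
    (hst : IsStationary μ fun i ω => (X i ω, Z i ω)) {k : ℕ} (hk : 0 < k) :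
    blockRateDistortion μ Z (channelDistortion W)
      (ENNReal.ofReal (condEntropy μ (Z 0) (X 0))) k =
        ((entropy μ (block Z k) / k - condEntropy μ (Z 0) (X 0) : ℝ) : EReal) := by
  have hk' : (0 : ℝ) < k := by positivity
  refine le_antisymm ?_ (le_iInf₂ fun V hV => ?_)
  · obtain ⟨V, hV, hD, hI⟩ := exists_channel_mutualInfo_eq hW hX hZ hXZ hst hk
    refine (iInf₂_le V ⟨hV, hD⟩).trans_eq ?_
    rw [hI, sub_div, mul_div_cancel_left₀ _ hk'.ne']
  · rw [EReal.coe_le_coe_iff, le_div_iff₀ hk', sub_mul, div_mul_cancel₀ _ hk'.ne']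
    have := le_mutualInfo_of_distortion hW hk (condEntropy_nonneg _ _) hV.1 hV.2
    linarith

lemma rateDistortion_eq (hW : IsChannel W) (hX : ∀ i, Measurable (X i))
    (hZ : ∀ i, Measurable (Z i)) (hXZ : IsMemorylessOutput μ X Z W)
    (hst : IsStationary μ fun i ω => (X i ω, Z i ω)) {l : ℝ}
    (hl : Tendsto (fun n : ℕ => entropy μ (block Z n) / n) atTop (𝓝 l)) :
    rateDistortion μ Z (channelDistortion W) (ENNReal.ofReal (condEntropy μ (Z 0) (X 0))) =
      ((l - condEntropy μ (Z 0) (X 0) : ℝ) : EReal) := by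
  refine Tendsto.limUnder_eq ((EReal.tendsto_coe.2 (hl.sub_const _)).congr' ?_)
  filter_upwards [eventually_gt_atTop 0] with k hk
  exact (blockRateDistortion_eq hW hX hZ hXZ hst hk).symm

/-- The normalized divergence of the law of `(Zⁿ, Yⁿ)` from the law of `Yⁿ` followed by the
channel vanishes for good reconstructions. -/
lemma IsGood.eventually_le (hW : IsChannel W) (hX : ∀ i, Measurable (X i))
    (hZ : ∀ i, Measurable (Z i)) (hXZ : IsMemorylessOutput μ X Z W)
    (hst : IsStationary μ fun i ω => (X i ω, Z i ω)) {Y : (n : ℕ) → Ω → Fin n → α}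
    (hY : ∀ n, Measurable (Y n))
    (hgood : IsGood μ Z (channelDistortion W) (ENNReal.ofReal (condEntropy μ (Z 0) (X 0))) Y)
    {η : ℝ} (hη : 0 < η) :
    ∀ᶠ n : ℕ in atTop, (∀ᵐ ω ∂μ, 0 < blockChannel W (Y n ω) (block Z n ω)) ∧
      ∫ ω, -Real.log (blockChannel W (Y n ω) (block Z n ω)) ∂μ - entropy μ (block Z n) +
        entropy μ (Y n) ≤ n * η := by
  obtain ⟨l, hl⟩ := exists_tendsto_entropy_block hZ (hst.snd hX hZ)
  set D := condEntropy μ (Z 0) (X 0) with hDdef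
  have hD : 0 ≤ D := condEntropy_nonneg _ _
  have hrate := hgood.rate_le
  rw [rateDistortion_eq hW hX hZ hXZ hst hl] at hrate
  have h1 : ∀ᶠ n : ℕ in atTop, entropy μ (Y n) / n < l - D + η / 3 := by
    have := eventually_lt_of_limsup_lt (hrate.trans_lt
      (EReal.coe_lt_coe_iff.2 (show l - D < l - D + η / 3 by linarith)))
    filter_upwards [this] with n hn using EReal.coe_lt_coe_iff.1 hn
  have h2 : ∀ᶠ n : ℕ in atTop, ∫⁻ ω, blockDistortion (channelDistortion W) (block Z n ω)
      (Y n ω) ∂μ < ENNReal.ofReal (D + η / 3) :=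
    eventually_lt_of_limsup_lt (hgood.distortion_le.trans_lt
      ((ENNReal.ofReal_lt_ofReal_iff (by positivity)).2 (by linarith)))
  have h3 : ∀ᶠ n : ℕ in atTop, l - η / 3 < entropy μ (block Z n) / n :=
    hl.eventually (lt_mem_nhds (by linarith))
  filter_upwards [h1, h2, h3, eventually_gt_atTop 0] with n h1 h2 h3 hn
  have hn' : (0 : ℝ) < n := by positivity
  have hYZ := (hY n).prodMk (measurable_block hZ n)
  -- Finite expected distortion excludes, almost surely, every pair the channel forbids.
  have hpos : ∀ᵐ ω ∂μ, 0 < blockChannel W (Y n ω) (block Z n ω) := by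
    have hm : Measurable fun ω => blockDistortion (channelDistortion W) (block Z n ω) (Y n ω) :=
      (measurable_of_finite fun t : (Fin n → α) × (Fin n → β) =>
        blockDistortion (channelDistortion W) t.2 t.1).comp hYZ
    filter_upwards [ae_lt_top hm (h2.trans_le le_top).ne] with ω hω
    by_contra hneg
    rw [blockDistortion_of_not_pos hW hneg] at hω
    exact lt_irrefl _ hω
  refine ⟨hpos, ?_⟩
  have h0 : ∀ ω, 0 ≤ -Real.log (blockChannel W (Y n ω) (block Z n ω)) / n := fun ω =>
    div_nonneg (neg_nonneg.2 (Real.log_nonpos ((hW.blockChannel n).nonneg _ _)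
      ((hW.blockChannel n).le_one _ _))) hn'.le
  have hint : Integrable (fun ω => -Real.log (blockChannel W (Y n ω) (block Z n ω)) / n) μ :=
    integrable_comp_fintype hYZ fun t => -Real.log (blockChannel W t.1 t.2) / n
  rw [lintegral_congr_ae (hpos.mono fun ω hω => blockDistortion_of_pos hW hω),
    ← ofReal_integral_eq_lintegral_ofReal hint (Eventually.of_forall h0),
    ENNReal.ofReal_lt_ofReal_iff (by positivity), integral_div, div_lt_iff₀ hn'] at h2
  rw [div_lt_iff₀ hn'] at h1
  rw [lt_div_iff₀ hn'] at h3
  -- The entropy rate `l` and the level `D` cancel, leaving three errors of `n * η / 3`.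
  nlinarith

end RateDistortion

/-! ### Invertible channels -/

section Invertible

variable {Ω α β : Type*} [Fintype α] [Fintype β]

lemma exists_rightInverse_of_linearIndependent [DecidableEq α] {W : Matrix α β ℝ}
    (h : LinearIndependent ℝ W.row) : ∃ R : Matrix β α ℝ, W * R = 1 := by
  rw [← Matrix.mulVec_surjective_iff_exists_right_inverse]
  have h1 : LinearMap.range W.mulVecLin = ⊤ := by
    apply Submodule.eq_top_of_finrank_eq
    rw [Module.finrank_fintype_fun_eq_card, ← h.rank_matrix]
    rfl
  exact LinearMap.range_eq_top.1 h1

/-- Invertibility in dual form: every function of the input is the conditional mean of a function of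
the output. The block channel is a tensor power of `W`, so the tensor power of a right inverse of
`W` inverts it. -/
lemma exists_blockChannel_preimage {W : Matrix α β ℝ}
    (h : LinearIndependent ℝ W.row) {m : ℕ} (G : (Fin m → α) → ℝ) :
    ∃ f : (Fin m → β) → ℝ, ∀ x, ∑ z, blockChannel W x z * f z = G x := by
  classical
  obtain ⟨R, hR⟩ := exists_rightInverse_of_linearIndependent h
  refine ⟨fun z => ∑ y, (∏ j, R (z j) (y j)) * G y, fun x => ?_⟩
  have h1 : ∀ y : Fin m → α, ∑ z : Fin m → β, blockChannel W x z * ∏ j, R (z j) (y j) =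
      if x = y then 1 else 0 := by
    intro y
    have h2 := Finset.prod_univ_sum (fun _ : Fin m => (Finset.univ : Finset β))
      fun j z => W (x j) z * R z (y j)
    rw [Fintype.piFinset_univ] at h2
    simp only [blockChannel, ← Finset.prod_mul_distrib]
    rw [← h2]
    have h3 : ∀ j, ∑ z, W (x j) z * R z (y j) = if x j = y j then 1 else 0 := fun j => by
      rw [← Matrix.mul_apply, hR, Matrix.one_apply]
    simp only [h3]
    split_ifs with hxy
    · simp [hxy]
    · obtain ⟨j, hj⟩ := Function.ne_iff.1 hxy
      exact Finset.prod_eq_zero (Finset.mem_univ j) (if_neg hj)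
  simp only [Finset.mul_sum, ← mul_assoc]
  rw [Finset.sum_comm]
  simp only [← Finset.sum_mul, h1]
  simp

variable [MeasurableSpace Ω] {μ : Measure Ω} [IsProbabilityMeasure μ]
  [MeasurableSpace α] [MeasurableSingletonClass α] [MeasurableSpace β] [MeasurableSingletonClass β]

/-- If `(S, V)` is close in total variation to `V` followed by the channel `w`, and `S` has the
law of the output of `w` with input law `r`, then expectations of `(S, V)` are close to those of
the pair of output and input. -/
lemma abs_integral_sub_le_of_channel {S : Ω → β} {V : Ω → α} (hS : Measurable S)
    (hV : Measurable V) {w : α → β → ℝ} {r : α → ℝ} {g : β → α → ℝ} {f : β → ℝ}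
    (hf : ∀ y, ∑ s, w y s * f s = ∑ s, w y s * g s y)
    (hr : ∀ s, ∑ y, r y * w y s = μ.real (S ⁻¹' {s})) :
    |∫ ω, g (S ω) (V ω) ∂μ - ∑ y, r y * ∑ s, w y s * g s y| ≤
      (∑ t : β × α, |g t.1 t.2 - f t.1|) * ∑ t : β × α,
        |μ.real ((fun ω => (S ω, V ω)) ⁻¹' {t}) - μ.real (V ⁻¹' {t.2}) * w t.2 t.1| := by
  have hSV := hS.prodMk hV
  -- Since `f` reads the output alone, its mean is the same under both input laws.
  have h1 : ∑ y, r y * ∑ s, w y s * g s y = ∑ t : β × α,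
      μ.real ((fun ω => (S ω, V ω)) ⁻¹' {t}) * f t.1 := by
    rw [← integral_comp_fintype hSV fun t => f t.1, integral_comp_fintype hS f]
    simp only [← hf, Finset.mul_sum, ← hr, Finset.sum_mul, ← mul_assoc]
    exact Finset.sum_comm
  -- Under the exact channel law `g - f` has conditional mean zero given the input, so only the
  -- deviation from that law contributes.
  have h2 : ∑ t : β × α, μ.real (V ⁻¹' {t.2}) * w t.2 t.1 * (g t.1 t.2 - f t.1) = 0 := by
    rw [Fintype.sum_prod_type_right]
    simp only [mul_assoc, ← Finset.mul_sum, mul_sub, Finset.sum_sub_distrib, hf, sub_self]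
    simp
  have h3 : ∫ ω, g (S ω) (V ω) ∂μ - ∑ y, r y * ∑ s, w y s * g s y = ∑ t : β × α,
      (g t.1 t.2 - f t.1) * (μ.real ((fun ω => (S ω, V ω)) ⁻¹' {t}) -
        μ.real (V ⁻¹' {t.2}) * w t.2 t.1) := by
    rw [integral_comp_fintype hSV fun t => g t.1 t.2, h1, ← sub_zero (_ - _), ← h2,
      ← Finset.sum_sub_distrib, ← Finset.sum_sub_distrib]
    exact Finset.sum_congr rfl fun t _ => by ring
  rw [h3, Finset.mul_sum]
  refine (Finset.abs_sum_le_sum_abs _ _).trans (Finset.sum_le_sum fun t _ => ?_)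
  rw [abs_mul]
  exact mul_le_mul_of_nonneg_right (Finset.single_le_sum (f := fun t : β × α =>
    |g t.1 t.2 - f t.1|) (fun _ _ => abs_nonneg _) (Finset.mem_univ t)) (abs_nonneg _)

/-- The constant precedes `V`, `a` and `ε`, so one value serves all reconstructions, block lengths
and window positions. -/
lemma exists_abs_integral_seqBlock_sub_le {X : ℤ → Ω → α} {Z : ℤ → Ω → β} {W : Matrix α β ℝ}
    [Nonempty α] (hW : IsChannel W) (hinv : LinearIndependent ℝ W.row)
    (hX : ∀ i, Measurable (X i)) (hZ : ∀ i, Measurable (Z i))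
    (hXZ : IsMemorylessOutput μ X Z W) (hst : IsStationary μ fun i ω => (X i ω, Z i ω))
    {m : ℕ} (g : (Fin m → β) → (Fin m → α) → ℝ) :
    ∃ C, 0 ≤ C ∧ ∀ V : ℕ → Ω → α, (∀ i, Measurable (V i)) →
      (∀ᵐ ω ∂μ, ∀ i, 0 < W (V i ω) (positivePart Z i ω)) → ∀ (a : ℕ) (ε : ℝ), 0 < ε →
        |∫ ω, g (seqBlock (positivePart Z) a m ω) (seqBlock V a m ω) ∂μ -
          ∫ ω, g (block Z m ω) (block X m ω) ∂μ| ≤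
            C * (channelGap μ W (positivePart Z) V a m / (2 * ε) + 2 * ε) := by
  have : Nonempty Ω := nonempty_of_isProbabilityMeasure μ
  have : Nonempty β := ⟨Z 0 (Classical.arbitrary Ω)⟩
  obtain ⟨f, hf⟩ := exists_blockChannel_preimage hinv fun y => ∑ s, blockChannel W y s * g s y
  refine ⟨∑ t : (Fin m → β) × (Fin m → α), |g t.1 t.2 - f t.1|,
    Finset.sum_nonneg fun _ _ => abs_nonneg _, fun V hV hpos a ε hε => ?_⟩
  have hU : ∀ i, Measurable (positivePart Z i) := fun i => hZ _
  have hZm := measurable_block hZ m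
  have hXm := measurable_block hX m
  have hr : ∀ s, ∑ y, μ.real (block X m ⁻¹' {y}) * blockChannel W y s =
      μ.real (seqBlock (positivePart Z) a m ⁻¹' {s}) := fun s => by
    rw [← map_measureReal_apply (measurable_seqBlock hU a m) (measurableSet_singleton s),
      (hst.snd hX hZ).map_seqBlock hZ, map_measureReal_apply hZm (measurableSet_singleton s),
      ← sum_measureReal_fiber_pair hXm]
    refine Finset.sum_congr rfl fun y _ => ?_
    rw [← hXZ.measureReal_block]
    congr 1
    ext ω
    simp [and_comm]
  have hXZint : ∫ ω, g (block Z m ω) (block X m ω) ∂μ =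
      ∑ y, μ.real (block X m ⁻¹' {y}) * ∑ s, blockChannel W y s * g s y := by
    rw [integral_comp_fintype (hZm.prodMk hXm) fun t => g t.1 t.2, Fintype.sum_prod_type_right]
    simp only [hXZ.measureReal_block, Finset.mul_sum, mul_assoc]
  rw [hXZint]
  refine (abs_integral_sub_le_of_channel (measurable_seqBlock hU a m)
    (measurable_seqBlock hV a m) hf hr).trans (mul_le_mul_of_nonneg_left ?_
      (Finset.sum_nonneg fun _ _ => abs_nonneg _))
  exact sum_abs_sub_channel_le (w := blockChannel W) (measurable_seqBlock hU a m)
    (measurable_seqBlock hV a m) (ae_blockChannel_pos hpos a m) (hW.blockChannel m).nonneg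
    (hW.blockChannel m).sum_eq_one hε

end Invertible

/-! ### Posteriors -/

section Posterior

variable {Ω α β : Type*} [MeasurableSpace Ω] {μ : Measure Ω} [IsProbabilityMeasure μ]
  [Fintype α] [Nonempty α] [MeasurableSpace α] [MeasurableSingletonClass α]
  [MeasurableSpace β] {X : ℤ → Ω → α} {Z : ℤ → Ω → β}

instance : IsMarkovKernel (posterior μ X Z) := by unfold posterior; infer_instance

instance (k : ℕ) : IsMarkovKernel (windowPosterior μ X Z k) := by
  unfold windowPosterior; infer_instance

lemma measurable_kernel_real {γ δ : Type*} [MeasurableSpace γ] [MeasurableSpace δ]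
    (κ : Kernel γ δ) {s : Set δ} (hs : MeasurableSet s) : Measurable fun c => (κ c).real s :=
  (κ.measurable_coe hs).ennreal_toReal

lemma measurable_window (k : ℕ) : Measurable (window k : (ℤ → β) → _) :=
  measurable_pi_lambda _ fun _ => measurable_pi_apply _

lemma integrable_of_abs_le {f : Ω → ℝ} (hf : Measurable f) {C : ℝ} (h : ∀ ω, |f ω| ≤ C) :
    Integrable f μ :=
  Integrable.of_bound hf.aestronglyMeasurable C (Eventually.of_forall h)

lemma integrable_mul_of_abs_le_one {f g : Ω → ℝ} (hf : Measurable f) (hg : Measurable g)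
    (hf1 : ∀ ω, |f ω| ≤ 1) (hg1 : ∀ ω, |g ω| ≤ 1) : Integrable (fun ω => f ω * g ω) μ :=
  integrable_of_abs_le (C := 1) (hf.mul hg) fun ω => by
    rw [abs_mul]
    exact mul_le_one₀ (hf1 ω) (abs_nonneg _) (hg1 ω)

lemma IsDoubleSidedMixing.eventually_abs_sub_le (h : IsDoubleSidedMixing μ X Z) {η : ℝ}
    (hη : 0 < η) : ∀ᶠ k in atTop, ∀ᵐ z ∂(μ.map (path Z)), ∀ x,
      |(windowPosterior μ X Z k (window k z)).real {x} - (posterior μ X Z z).real {x}| ≤ η := by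
  filter_upwards [h.tendsto_zero.eventually (gt_mem_nhds (ENNReal.ofReal_pos.2 hη))] with k hk
  have h1 := ae_le_essSup (μ := μ.map (path Z)) (f := fun z : ℤ → β => ⨆ x : α,
    ‖(windowPosterior μ X Z k (window k z)).real {x} - (posterior μ X Z z).real {x}‖ₑ)
  filter_upwards [h1] with z hz x
  have h2 := (le_iSup (fun x : α => ‖(windowPosterior μ X Z k (window k z)).real {x} -
    (posterior μ X Z z).real {x}‖ₑ) x).trans (hz.trans hk.le)
  rw [Real.enorm_eq_ofReal_abs] at h2
  exact (ENNReal.ofReal_le_ofReal_iff hη.le).1 h2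

lemma abs_indicator_le_one {γ : Type*} (s : Set γ) (c : γ) : |s.indicator (1 : γ → ℝ) c| ≤ 1 := by
  by_cases h : c ∈ s <;> simp [h]

lemma measurable_indicator_singleton {γ : Type*} [MeasurableSpace γ] [MeasurableSingletonClass γ]
    (c : γ) : Measurable (Set.indicator {c} (1 : γ → ℝ)) :=
  measurable_one.indicator (measurableSet_singleton c)

lemma integral_indicator_mul_eq_posterior (hX : ∀ i, Measurable (X i))
    (hZ : ∀ i, Measurable (Z i)) (x : α) {φ : (ℤ → β) → ℝ} (hφ : Measurable φ)
    (hφ1 : ∀ z, |φ z| ≤ 1) :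
    ∫ ω, Set.indicator {x} 1 (X 0 ω) * φ (path Z ω) ∂μ =
      ∫ ω, (posterior μ X Z (path Z ω)).real {x} * φ (path Z ω) ∂μ := by
  have hZp := measurable_path hZ
  have hm : Measurable fun p : (ℤ → β) × α => Set.indicator {x} (1 : α → ℝ) p.2 * φ p.1 :=
    ((measurable_indicator_singleton x).comp measurable_snd).mul (hφ.comp measurable_fst)
  have hb : ∀ p : (ℤ → β) × α, |Set.indicator {x} (1 : α → ℝ) p.2 * φ p.1| ≤ 1 := fun p => by
    rw [abs_mul]
    exact mul_le_one₀ (abs_indicator_le_one _ _) (abs_nonneg _) (hφ1 _)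
  have h1 : (μ.map (path Z)) ⊗ₘ (posterior μ X Z) = μ.map fun ω => (path Z ω, X 0 ω) :=
    compProd_map_condDistrib (hX 0).aemeasurable
  have : IsProbabilityMeasure (μ.map (path Z)) :=
    Measure.isProbabilityMeasure_map hZp.aemeasurable
  have h2 := integral_map (μ := μ) (hZp.prodMk (hX 0)).aemeasurable hm.aestronglyMeasurable
  rw [← h1, Measure.integral_compProd (integrable_of_abs_le hm hb)] at h2
  rw [← h2, integral_map hZp.aemeasurable]
  · refine integral_congr_ae (Eventually.of_forall fun ω => ?_)
    dsimp only
    rw [integral_mul_const, integral_indicator_one (measurableSet_singleton x)]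
  · simp only [integral_mul_const, integral_indicator_one (measurableSet_singleton x)]
    exact ((measurable_kernel_real _ (measurableSet_singleton x)).mul hφ).aestronglyMeasurable

omit [Fintype α] [Nonempty α] [MeasurableSingletonClass α] in
lemma abs_kernel_real_le_one {γ : Type*} [MeasurableSpace γ] (κ : Kernel γ α) [IsMarkovKernel κ]
    (c : γ) (s : Set α) : |(κ c).real s| ≤ 1 := by
  rw [abs_of_nonneg measureReal_nonneg]
  exact measureReal_le_one

lemma abs_integral_mul_sub_le {f f' φ : Ω → ℝ} (hf : Measurable f) (hf' : Measurable f')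
    (hφ : Measurable φ) (h1 : ∀ ω, |f ω| ≤ 1) (h1' : ∀ ω, |f' ω| ≤ 1) (hφ1 : ∀ ω, |φ ω| ≤ 1)
    {η : ℝ} (h : ∀ᵐ ω ∂μ, |f ω - f' ω| ≤ η) :
    |∫ ω, f ω * φ ω ∂μ - ∫ ω, f' ω * φ ω ∂μ| ≤ η := by
  rw [← integral_sub (integrable_mul_of_abs_le_one hf hφ h1 hφ1)
    (integrable_mul_of_abs_le_one hf' hφ h1' hφ1)]
  have h2 := norm_integral_le_of_norm_le_const (μ := μ) (f := fun ω => f ω * φ ω - f' ω * φ ω)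
    (C := η) ?_
  · simpa using h2
  · filter_upwards [h] with ω hω
    rw [← sub_mul, Real.norm_eq_abs, abs_mul]
    exact (mul_le_of_le_one_right (abs_nonneg _) (hφ1 ω)).trans hω

variable {k : ℕ} {η : ℝ}

/-- Predicting `X₀ = x` from a window of `Z` rather than the whole path changes expectations
against bounded functions of `Z` by at most the mixing coefficient. -/
lemma abs_integral_indicator_sub_windowPosterior_le (hX : ∀ i, Measurable (X i))
    (hZ : ∀ i, Measurable (Z i)) (hk : ∀ᵐ z ∂(μ.map (path Z)), ∀ x,
      |(windowPosterior μ X Z k (window k z)).real {x} - (posterior μ X Z z).real {x}| ≤ η)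
    (x : α) {φ : (ℤ → β) → ℝ} (hφ : Measurable φ) (hφ1 : ∀ z, |φ z| ≤ 1) :
    |∫ ω, Set.indicator {x} 1 (X 0 ω) * φ (path Z ω) ∂μ -
      ∫ ω, (windowPosterior μ X Z k (window k (path Z ω))).real {x} * φ (path Z ω) ∂μ| ≤ η := by
  have hZp := measurable_path hZ
  rw [integral_indicator_mul_eq_posterior hX hZ x hφ hφ1, abs_sub_comm]
  exact abs_integral_mul_sub_le
    (((measurable_kernel_real _ (measurableSet_singleton x)).comp (measurable_window k)).comp hZp)
    ((measurable_kernel_real _ (measurableSet_singleton x)).comp hZp) (hφ.comp hZp)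
    (fun _ => abs_kernel_real_le_one _ _ _) (fun _ => abs_kernel_real_le_one _ _ _)
    (fun _ => hφ1 _) ((ae_of_ae_map hZp.aemeasurable hk).mono fun ω h => h x)

/-- The loss expected by an observer of the window `w` when the reconstruction is `y`. -/
noncomputable def windowLoss (μ : Measure Ω) [IsProbabilityMeasure μ] (X : ℤ → Ω → α)
    (Z : ℤ → Ω → β) (Λ : α → α → ℝ) (k : ℕ) (w : Finset.Icc (-(k : ℤ)) k → β) (y : α) : ℝ :=
  ∑ x, (windowPosterior μ X Z k w).real {x} * Λ x y

lemma eq_sum_indicator_mul {γ : Type*} [Fintype γ] (f : γ → ℝ) (c : γ) :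
    f c = ∑ x, Set.indicator {x} 1 c * f x := by
  classical
  rw [Finset.sum_eq_single c] <;> simp +contextual [eq_comm]

/-- The limiting loss: both arguments are drawn from the posterior. -/
lemma integral_posterior_prod (hZ : ∀ i, Measurable (Z i)) (Λ : α → α → ℝ) :
    ∫ z, ∫ p : α × α, Λ p.1 p.2 ∂((posterior μ X Z z).prod (posterior μ X Z z))
      ∂(μ.map (path Z)) = ∑ x, ∑ y, Λ x y *
        ∫ ω, (posterior μ X Z (path Z ω)).real {x} * (posterior μ X Z (path Z ω)).real {y} ∂μ := by
  have hZp := measurable_path hZ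
  have hm : ∀ x, Measurable fun z => (posterior μ X Z z).real {x} := fun x =>
    measurable_kernel_real _ (measurableSet_singleton x)
  have h1 : ∀ z, ∫ p : α × α, Λ p.1 p.2 ∂((posterior μ X Z z).prod (posterior μ X Z z)) =
      ∑ x, ∑ y, Λ x y * ((posterior μ X Z z).real {x} * (posterior μ X Z z).real {y}) := fun z => by
    rw [integral_fintype Integrable.of_finite, Fintype.sum_prod_type]
    refine Finset.sum_congr rfl fun x _ => Finset.sum_congr rfl fun y _ => ?_
    rw [← Set.singleton_prod_singleton, measureReal_prod_prod, smul_eq_mul, mul_comm]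
  simp only [h1]
  rw [integral_map hZp.aemeasurable]
  · have hi : ∀ x y, Integrable (fun ω => Λ x y * ((posterior μ X Z (path Z ω)).real {x} *
        (posterior μ X Z (path Z ω)).real {y})) μ := fun x y =>
      (integrable_mul_of_abs_le_one ((hm x).comp hZp) ((hm y).comp hZp)
        (fun _ => abs_kernel_real_le_one _ _ _)
        (fun _ => abs_kernel_real_le_one _ _ _)).const_mul _
    rw [integral_finsetSum _ fun x _ => integrable_finsetSum _ fun y _ => hi x y]
    refine Finset.sum_congr rfl fun x _ => ?_
    rw [integral_finsetSum _ fun y _ => hi x y]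
    exact Finset.sum_congr rfl fun y _ => integral_const_mul _ _
  · refine Measurable.aestronglyMeasurable ?_
    exact Finset.measurable_sum _ fun x _ => Finset.measurable_sum _ fun y _ =>
      measurable_const.mul ((hm x).mul (hm y))

lemma abs_sum_mul_sub_le {γ : Type*} [Fintype γ] (Λ a b : γ → ℝ) (h : ∀ c, |a c - b c| ≤ η) :
    |∑ c, Λ c * a c - ∑ c, Λ c * b c| ≤ (∑ c, |Λ c|) * η := by
  rw [← Finset.sum_sub_distrib, Finset.sum_mul]
  refine (Finset.abs_sum_le_sum_abs _ _).trans (Finset.sum_le_sum fun c _ => ?_)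
  rw [← mul_sub, abs_mul]
  exact mul_le_mul_of_nonneg_left (h c) (abs_nonneg _)

/-- Expectation of a window loss, expanded over the alphabet. -/
lemma integral_windowLoss {w : Ω → Finset.Icc (-(k : ℤ)) k → β} (hw : Measurable w) {V : Ω → α}
    (hV : Measurable V) (Λ : α → α → ℝ) :
    ∫ ω, windowLoss μ X Z Λ k (w ω) (V ω) ∂μ = ∑ t : α × α, Λ t.1 t.2 *
      ∫ ω, (windowPosterior μ X Z k (w ω)).real {t.1} * Set.indicator {t.2} 1 (V ω) ∂μ := by
  have hi : ∀ t : α × α, Integrable (fun ω => Λ t.1 t.2 *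
      ((windowPosterior μ X Z k (w ω)).real {t.1} * Set.indicator {t.2} 1 (V ω))) μ := fun t =>
    (integrable_mul_of_abs_le_one
      ((measurable_kernel_real _ (measurableSet_singleton t.1)).comp hw)
      ((measurable_indicator_singleton t.2).comp hV) (fun _ => abs_kernel_real_le_one _ _ _)
      (fun _ => abs_indicator_le_one _ _)).const_mul _
  simp only [← integral_const_mul]
  rw [← integral_finsetSum _ fun t _ => hi t]
  refine integral_congr_ae (Eventually.of_forall fun ω => ?_)
  dsimp only
  rw [Fintype.sum_prod_type, windowLoss]
  refine Finset.sum_congr rfl fun x _ => ?_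
  rw [eq_sum_indicator_mul (Λ x) (V ω), Finset.mul_sum]
  exact Finset.sum_congr rfl fun y _ => by ring

/-- Conditioning on the path of `Z` replaces the letter `X₀` by its posterior exactly; replacing the
window posterior of the other letter by the full one costs at most `η` per pair of letters. -/
lemma abs_integral_windowLoss_sub_le (hX : ∀ i, Measurable (X i))
    (hZ : ∀ i, Measurable (Z i)) (hk : ∀ᵐ z ∂(μ.map (path Z)), ∀ x,
      |(windowPosterior μ X Z k (window k z)).real {x} - (posterior μ X Z z).real {x}| ≤ η)
    (Λ : α → α → ℝ) :
    |∫ ω, windowLoss μ X Z Λ k (window k (path Z ω)) (X 0 ω) ∂μ -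
      ∫ z, ∫ p : α × α, Λ p.1 p.2 ∂((posterior μ X Z z).prod (posterior μ X Z z))
        ∂(μ.map (path Z))| ≤ (∑ t : α × α, |Λ t.1 t.2|) * η := by
  have hZp := measurable_path hZ
  rw [integral_posterior_prod hZ, integral_windowLoss
    (w := fun ω => window k (path Z ω)) ((measurable_window k).comp hZp) (hX 0),
    ← Fintype.sum_prod_type' fun x y => Λ x y * ∫ ω, (posterior μ X Z (path Z ω)).real {x} *
      (posterior μ X Z (path Z ω)).real {y} ∂μ]
  refine abs_sum_mul_sub_le (fun t : α × α => Λ t.1 t.2) _ _ fun t => ?_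
  have hc : Measurable fun z : ℤ → β => (windowPosterior μ X Z k (window k z)).real {t.1} :=
    (measurable_kernel_real _ (measurableSet_singleton t.1)).comp (measurable_window k)
  have h1 := integral_indicator_mul_eq_posterior (μ := μ) hX hZ t.2 hc
    fun z => abs_kernel_real_le_one _ _ _
  simp only [mul_comm (Set.indicator _ _ _), mul_comm ((posterior μ X Z _).real {t.2})] at h1
  refine (congrArg (fun r => |r - _|) h1).trans_le ?_
  exact abs_integral_mul_sub_le (hc.comp hZp)
    ((measurable_kernel_real _ (measurableSet_singleton t.1)).comp hZp)
    ((measurable_kernel_real _ (measurableSet_singleton t.2)).comp hZp)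
    (fun _ => abs_kernel_real_le_one _ _ _) (fun _ => abs_kernel_real_le_one _ _ _)
    (fun _ => abs_kernel_real_le_one _ _ _)
    ((ae_of_ae_map hZp.aemeasurable hk).mono fun ω h => h t.1)

end Posterior

/-! ### Randomized reconstructions as functions of the output in expectation -/

section Markov

variable {Ω α β γ : Type*} [MeasurableSpace Ω] {μ : Measure Ω} [IsProbabilityMeasure μ]
  [Fintype α] [MeasurableSpace α] [MeasurableSingletonClass α]
  [Fintype β] [MeasurableSpace β] [MeasurableSingletonClass β]
  [Fintype γ] [MeasurableSpace γ] [MeasurableSingletonClass γ]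

omit [Fintype α] [Fintype β] [Fintype γ] in
lemma IsMarkovChain.measureReal_eq {U : Ω → α} {V : Ω → β} {T : Ω → γ}
    (h : IsMarkovChain μ U V T) (hV : Measurable V) (u : α) (v : β) (t : γ) :
    μ.real ((fun ω => ((U ω, V ω), T ω)) ⁻¹' {((u, v), t)}) =
      μ.real ((fun ω => (U ω, V ω)) ⁻¹' {(u, v)}) * (cond μ (V ⁻¹' {v})).real (T ⁻¹' {t}) := by
  have hv := hV (measurableSet_singleton v)
  have e1 : (fun ω => ((U ω, V ω), T ω)) ⁻¹' {((u, v), t)} =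
      V ⁻¹' {v} ∩ (U ⁻¹' {u} ∩ T ⁻¹' {t}) := by
    ext ω
    simp only [Set.mem_preimage, Set.mem_singleton_iff, Prod.mk.injEq, Set.mem_inter_iff]
    tauto
  have e2 : (fun ω => (U ω, V ω)) ⁻¹' {(u, v)} = V ⁻¹' {v} ∩ U ⁻¹' {u} := by
    ext ω
    simp only [Set.mem_preimage, Set.mem_singleton_iff, Prod.mk.injEq, Set.mem_inter_iff]
    tauto
  have hi := congrArg ENNReal.toReal ((h v).measure_inter_preimage_eq_mul _ _
    (measurableSet_singleton u) (measurableSet_singleton t))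
  rw [ENNReal.toReal_mul] at hi
  change (cond μ (V ⁻¹' {v})).real _ =
    (cond μ (V ⁻¹' {v})).real _ * (cond μ (V ⁻¹' {v})).real _ at hi
  rw [e1, e2]
  rcases (measureReal_nonneg (μ := μ) (s := V ⁻¹' {v})).eq_or_lt with h0 | h0
  · have hz : ∀ s, μ.real (V ⁻¹' {v} ∩ s) = 0 := fun s =>
      le_antisymm ((measureReal_mono Set.inter_subset_left).trans_eq h0.symm) measureReal_nonneg
    rw [hz, hz, zero_mul]
  · rw [measureReal_cond hv, measureReal_cond hv (U ⁻¹' {u}), mul_assoc] at hi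
    exact mul_left_cancel₀ (inv_ne_zero h0.ne') hi

/-- Along a Markov chain `U — V — T`, a bounded function of `T` may be replaced by a function of
`V` in expectations against functions of `(U, V)`. -/
lemma IsMarkovChain.exists_integral_eq {U : Ω → α} {V : Ω → β} {T : Ω → γ}
    (h : IsMarkovChain μ U V T) (hU : Measurable U) (hV : Measurable V) (hT : Measurable T)
    {r : γ → ℝ} (hr : ∀ t, |r t| ≤ 1) :
    ∃ φ : β → ℝ, (∀ v, |φ v| ≤ 1) ∧ ∀ f : α → β → ℝ,
      ∫ ω, f (U ω) (V ω) * r (T ω) ∂μ = ∫ ω, f (U ω) (V ω) * φ (V ω) ∂μ := by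
  refine ⟨fun v => ∑ t, (cond μ (V ⁻¹' {v})).real (T ⁻¹' {t}) * r t, fun v => ?_, fun f => ?_⟩
  · calc |∑ t, (cond μ (V ⁻¹' {v})).real (T ⁻¹' {t}) * r t|
        ≤ ∑ t, |(cond μ (V ⁻¹' {v})).real (T ⁻¹' {t}) * r t| := Finset.abs_sum_le_sum_abs _ _
      _ ≤ ∑ t, (cond μ (V ⁻¹' {v})).real (T ⁻¹' {t}) := Finset.sum_le_sum fun t _ => by
          rw [abs_mul, abs_of_nonneg measureReal_nonneg]
          exact mul_le_of_le_one_right measureReal_nonneg (hr t)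
      _ = (cond μ (V ⁻¹' {v})).real (T ⁻¹' (Finset.univ : Finset γ)) :=
          sum_measureReal_preimage_singleton _ fun t _ => hT (measurableSet_singleton t)
      -- Not an equality: conditioning on a null event gives the zero measure.
      _ ≤ 1 := measureReal_le_one
  · rw [integral_comp_fintype ((hU.prodMk hV).prodMk hT) fun t => f t.1.1 t.1.2 * r t.2,
      integral_comp_fintype (hU.prodMk hV) fun t => f t.1 t.2 *
        ∑ s, (cond μ (V ⁻¹' {t.2})).real (T ⁻¹' {s}) * r s, Fintype.sum_prod_type]
    refine Finset.sum_congr rfl fun t _ => ?_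
    simp only [Finset.mul_sum]
    refine Finset.sum_congr rfl fun s _ => ?_
    rw [h.measureReal_eq hV]
    ring

end Markov

/-! ### Windows of the output inside blocks -/

section Window

variable {Ω α β : Type*} [MeasurableSpace Ω] {μ : Measure Ω} [IsProbabilityMeasure μ]
  [Fintype α] [Nonempty α] [MeasurableSpace α] [MeasurableSingletonClass α]
  [Fintype β] [MeasurableSpace β] [MeasurableSingletonClass β]
  {X : ℤ → Ω → α} {Z : ℤ → Ω → β}

/-- A block of odd length, indexed symmetrically. -/
def windowOfBlock (k : ℕ) (b : Fin (2 * k + 1) → β) : Finset.Icc (-(k : ℤ)) k → β :=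
  fun j => b ⟨((j : ℤ) + k).toNat, by have := Finset.mem_Icc.1 j.2; omega⟩

omit [MeasurableSpace Ω] [Fintype β] [MeasurableSpace β] [MeasurableSingletonClass β] in
-- The block starting at index `a` covers the times `a + 1, …, a + 2k + 1`, whose centre is `a + k +
-- 1`.
lemma windowOfBlock_seqBlock (Z : ℤ → Ω → β) (k a : ℕ) (ω : Ω) :
    windowOfBlock k (seqBlock (positivePart Z) a (2 * k + 1) ω) =
      window k (path (fun i => Z (i + (a + k + 1 : ℕ))) ω) := by
  funext j
  have := Finset.mem_Icc.1 j.2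
  simp only [windowOfBlock, seqBlock, positivePart, window, path]
  congr 1
  push_cast
  omega

omit [IsProbabilityMeasure μ] in
lemma integral_path_shift {δ : Type*} [MeasurableSpace δ] {P : ℤ → Ω → δ}
    (h : IsStationary μ P) (hP : ∀ i, Measurable (P i)) {F : (ℤ → δ) → ℝ} (hF : Measurable F)
    (N : ℕ) : ∫ ω, F (path (fun i => P (i + N)) ω) ∂μ = ∫ ω, F (path P ω) ∂μ := by
  rw [← integral_map (measurable_path fun i => hP _).aemeasurable hF.aestronglyMeasurable,
    h.map_shift hP, integral_map (measurable_path hP).aemeasurable hF.aestronglyMeasurable]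

variable {k : ℕ} {η : ℝ}

/-- The window loss as a function of blocks of `Z` and `Y`. -/
noncomputable def blockWindowLoss (μ : Measure Ω) [IsProbabilityMeasure μ] (X : ℤ → Ω → α)
    (Z : ℤ → Ω → β) (Λ : α → α → ℝ) (k : ℕ) (z : Fin (2 * k + 1) → β)
    (y : Fin (2 * k + 1) → α) : ℝ :=
  windowLoss μ X Z Λ k (windowOfBlock k z) (y ⟨k, by omega⟩)

omit [Fintype β] [MeasurableSingletonClass β] in
lemma measurable_windowLoss (Λ : α → α → ℝ) :
    Measurable fun p : (Finset.Icc (-(k : ℤ)) k → β) × α => windowLoss μ X Z Λ k p.1 p.2 := by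
  refine Finset.measurable_sum _ fun x _ => ?_
  exact ((measurable_kernel_real _ (measurableSet_singleton x)).comp measurable_fst).mul
    ((measurable_of_finite _).comp measurable_snd)

omit [Fintype β] [MeasurableSingletonClass β] in
lemma integral_blockWindowLoss_block (hX : ∀ i, Measurable (X i)) (hZ : ∀ i, Measurable (Z i))
    (hst : IsStationary μ fun i ω => (X i ω, Z i ω)) (Λ : α → α → ℝ) :
    ∫ ω, blockWindowLoss μ X Z Λ k (block Z (2 * k + 1) ω) (block X (2 * k + 1) ω) ∂μ =
      ∫ ω, windowLoss μ X Z Λ k (window k (path Z ω)) (X 0 ω) ∂μ := by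
  have hsnd : Measurable fun (s : ℤ → α × β) i => (s i).2 := by fun_prop
  have hfst : Measurable fun (s : ℤ → α × β) => (s 0).1 := by fun_prop
  have hwin : Measurable fun s : ℤ → α × β => (window k fun i => (s i).2, (s 0).1) :=
    ((measurable_window k).comp hsnd).prodMk hfst
  have hF := (measurable_windowLoss (μ := μ) (X := X) (Z := Z) (k := k) Λ).comp hwin
  have h2 := integral_path_shift hst (fun i => (hX i).prodMk (hZ i)) hF (k + 1)
  refine Eq.trans (integral_congr_ae (Eventually.of_forall fun ω => ?_)) h2
  dsimp only
  have h3 := windowOfBlock_seqBlock Z k 0 ω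
  have h4 : block X (2 * k + 1) ω ⟨k, by omega⟩ = X (0 + (k + 1 : ℕ)) ω := by simp [block]
  rw [seqBlock_positivePart_zero, zero_add] at h3
  rw [blockWindowLoss, h3, h4]
  rfl

/-- A reconstruction that is a Markov function of `Zⁿ` incurs, up to the mixing coefficient, the
loss expected by an observer of a window of `Z`. -/
lemma abs_integral_loss_sub_blockWindowLoss_le (hX : ∀ i, Measurable (X i))
    (hZ : ∀ i, Measurable (Z i)) (hst : IsStationary μ fun i ω => (X i ω, Z i ω))
    (hk : ∀ᵐ z ∂(μ.map (path Z)), ∀ x,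
      |(windowPosterior μ X Z k (window k z)).real {x} - (posterior μ X Z z).real {x}| ≤ η)
    (Λ : α → α → ℝ) {n : ℕ} {Y : Ω → Fin n → α} (hY : Measurable Y)
    (hM : IsMarkovChain μ (block X n) (block Z n) Y) {V : ℕ → Ω → α}
    (hV : ∀ i (hi : i < n) ω, V i ω = Y ω ⟨i, hi⟩) {a : ℕ} (ha : a + 2 * k + 1 ≤ n) :
    |∫ ω, Λ (positivePart X (a + k) ω) (V (a + k) ω) ∂μ -
      ∫ ω, blockWindowLoss μ X Z Λ k (seqBlock (positivePart Z) a (2 * k + 1) ω)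
        (seqBlock V a (2 * k + 1) ω) ∂μ| ≤ (∑ t : α × α, |Λ t.1 t.2|) * η := by
  have hi : a + k < n := by omega
  have hVi : V (a + k) = fun ω => Y ω ⟨a + k, hi⟩ := funext fun ω => hV _ hi ω
  have hVm : Measurable (V (a + k)) := by
    rw [hVi]
    exact (measurable_pi_apply _).comp hY
  have hXm : Measurable (positivePart X (a + k)) := hX _
  have hSm := measurable_seqBlock (U := positivePart Z) (fun i => hZ _) a (2 * k + 1)
  have hwm : Measurable fun ω => windowOfBlock k (seqBlock (positivePart Z) a (2 * k + 1) ω) :=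
    (measurable_of_finite (windowOfBlock k)).comp hSm
  have h1 : ∫ ω, Λ (positivePart X (a + k) ω) (V (a + k) ω) ∂μ = ∑ t : α × α, Λ t.1 t.2 *
      ∫ ω, Set.indicator {t.1} 1 (positivePart X (a + k) ω) *
        Set.indicator {t.2} 1 (V (a + k) ω) ∂μ := by
    simp only [← integral_const_mul]
    rw [← integral_finsetSum _ fun t _ => (integrable_mul_of_abs_le_one
      ((measurable_indicator_singleton t.1).comp hXm)
      ((measurable_indicator_singleton t.2).comp hVm) (fun _ => abs_indicator_le_one _ _)
      (fun _ => abs_indicator_le_one _ _)).const_mul _]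
    refine integral_congr_ae (Eventually.of_forall fun ω => ?_)
    dsimp only
    rw [eq_sum_indicator_mul (fun x => Λ x (V (a + k) ω)), Fintype.sum_prod_type]
    refine Finset.sum_congr rfl fun x _ => ?_
    rw [eq_sum_indicator_mul (Λ x) (V (a + k) ω), Finset.mul_sum]
    exact Finset.sum_congr rfl fun y _ => by ring
  have h2 : ∀ ω, blockWindowLoss μ X Z Λ k (seqBlock (positivePart Z) a (2 * k + 1) ω)
      (seqBlock V a (2 * k + 1) ω) = windowLoss μ X Z Λ k
        (windowOfBlock k (seqBlock (positivePart Z) a (2 * k + 1) ω)) (V (a + k) ω) :=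
    fun ω => rfl
  simp only [h2]
  rw [h1, integral_windowLoss hwm hVm]
  refine abs_sum_mul_sub_le (fun t : α × α => Λ t.1 t.2) _ _ fun t => ?_
  -- The same function of `Zⁿ` replaces the indicator of the reconstructed letter in both integrals,
  -- so they can be compared.
  obtain ⟨φ, hφ1, hφ⟩ := hM.exists_integral_eq (measurable_block hX n) (measurable_block hZ n) hY
    (r := fun y => Set.indicator {t.2} 1 (y ⟨a + k, hi⟩)) fun y => abs_indicator_le_one _ _
  have e1 := hφ fun x _ => Set.indicator {t.1} 1 (x ⟨a + k, hi⟩)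
  have e2 := hφ fun _ z => (windowPosterior μ X Z k (windowOfBlock k fun j : Fin (2 * k + 1) =>
    z ⟨a + j, by omega⟩)).real {t.1}
  have hX' : ∀ ω, block X n ω ⟨a + k, hi⟩ = positivePart X (a + k) ω := fun ω => rfl
  have hS' : ∀ ω, (fun j : Fin (2 * k + 1) => block Z n ω ⟨a + j, by omega⟩) =
      seqBlock (positivePart Z) a (2 * k + 1) ω := fun ω => rfl
  simp only [hX', hS'] at e1 e2
  simp only [hVi]
  rw [e1, e2]
  set N := a + k + 1 with hN
  -- `ψ` is `φ` recentred: the window is moved to time `0`, where the mixing bound applies.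
  set ψ : (ℤ → β) → ℝ := fun s => φ fun j => s ((j : ℤ) + 1 - N) with hψ
  have hψm : Measurable ψ := (measurable_of_finite φ).comp
    (measurable_pi_lambda _ fun j => measurable_pi_apply _)
  have hsnd : Measurable fun (s : ℤ → α × β) i => (s i).2 := by fun_prop
  have hfst : Measurable fun (s : ℤ → α × β) => (s 0).1 := by fun_prop
  have hPm := fun i => (hX i).prodMk (hZ i)
  have hψZ : ∀ ω, ψ (path (fun i => Z (i + N)) ω) = φ (block Z n ω) := fun ω => by
    simp only [hψ, path]
    congr 1
    funext j
    simp [block]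
  have f1 := integral_path_shift hst hPm (F := fun s => Set.indicator {t.1} 1 (s 0).1 *
    ψ fun i => (s i).2) (((measurable_indicator_singleton t.1).comp hfst).mul (hψm.comp hsnd)) N
  have f2 := integral_path_shift hst hPm (F := fun s =>
    (windowPosterior μ X Z k (window k fun i => (s i).2)).real {t.1} * ψ fun i => (s i).2)
    ((((measurable_kernel_real _ (measurableSet_singleton t.1)).comp (measurable_window k)).comp
      hsnd).mul (hψm.comp hsnd)) N
  have g1 : ∫ ω, Set.indicator {t.1} 1 (positivePart X (a + k) ω) * φ (block Z n ω) ∂μ =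
      ∫ ω, Set.indicator {t.1} 1 (X 0 ω) * ψ (path Z ω) ∂μ := by
    refine Eq.trans (integral_congr_ae (Eventually.of_forall fun ω => ?_)) f1
    dsimp only
    have h3 : positivePart X (a + k) ω = X (0 + N) ω := by simp [positivePart, hN]
    rw [← hψZ, h3]
    rfl
  have g2 : ∫ ω, (windowPosterior μ X Z k (windowOfBlock k
      (seqBlock (positivePart Z) a (2 * k + 1) ω))).real {t.1} * φ (block Z n ω) ∂μ =
      ∫ ω, (windowPosterior μ X Z k (window k (path Z ω))).real {t.1} * ψ (path Z ω) ∂μ := by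
    refine Eq.trans (integral_congr_ae (Eventually.of_forall fun ω => ?_)) f2
    dsimp only
    rw [← hψZ, windowOfBlock_seqBlock]
    rfl
  rw [g1, g2]
  exact abs_integral_indicator_sub_windowPosterior_le hX hZ hk t.1 hψm fun s => hφ1 _

end Window

/-! ### The limiting loss of good reconstructions -/

/-- The `k` positions at each end have no full window around them and are bounded trivially. -/
lemma abs_sum_range_le {e : ℕ → ℝ} {b : ℝ} {k M : ℕ} (he : ∀ i < M + 2 * k, |e i| ≤ b) :
    |∑ i ∈ Finset.range (M + 2 * k), e i| ≤
      2 * k * b + ∑ a ∈ Finset.range M, |e (a + k)| := by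
  rw [show M + 2 * k = k + M + k by ring] at he ⊢
  rw [Finset.sum_range_add, Finset.sum_range_add]
  have h1 : |∑ i ∈ Finset.range k, e i| ≤ k * b :=
    (Finset.abs_sum_le_sum_abs _ _).trans ((Finset.sum_le_card_nsmul _ _ b fun i hi =>
      he i (by have := Finset.mem_range.1 hi; omega)).trans_eq (by simp))
  have h2 : |∑ i ∈ Finset.range k, e (k + M + i)| ≤ k * b :=
    (Finset.abs_sum_le_sum_abs _ _).trans ((Finset.sum_le_card_nsmul _ _ b fun i hi =>
      he _ (by have := Finset.mem_range.1 hi; omega)).trans_eq (by simp))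
  have h3 : |∑ i ∈ Finset.range M, e (k + i)| ≤ ∑ a ∈ Finset.range M, |e (a + k)| := by
    simp only [add_comm k]
    exact Finset.abs_sum_le_sum_abs _ _
  have h4 := abs_add_le (∑ i ∈ Finset.range k, e i + ∑ i ∈ Finset.range M, e (k + i))
    (∑ i ∈ Finset.range k, e (k + M + i))
  have h5 := abs_add_le (∑ i ∈ Finset.range k, e i) (∑ i ∈ Finset.range M, e (k + i))
  linarith

section Main

variable {Ω α β : Type*} [MeasurableSpace Ω] {μ : Measure Ω} [IsProbabilityMeasure μ]
  [Fintype α] [Nonempty α] [MeasurableSpace α] [MeasurableSingletonClass α]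
  [Fintype β] [MeasurableSpace β] [MeasurableSingletonClass β]
  {X : ℤ → Ω → α} {Z : ℤ → Ω → β} {W : Matrix α β ℝ}

/-- The reconstruction `Yⁿ`, continued by the input process. -/
def extendByInput (X : ℤ → Ω → α) {n : ℕ} (Y : Ω → Fin n → α) (i : ℕ) (ω : Ω) : α :=
  if h : i < n then Y ω ⟨i, h⟩ else positivePart X i ω

omit [MeasurableSpace Ω] [Fintype α] [Nonempty α] [MeasurableSpace α]
  [MeasurableSingletonClass α] in
lemma extendByInput_of_lt {n : ℕ} (Y : Ω → Fin n → α) (i : ℕ) (hi : i < n) (ω : Ω) :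
    extendByInput X Y i ω = Y ω ⟨i, hi⟩ := dif_pos hi

omit [MeasurableSpace Ω] [Fintype α] [Nonempty α] [MeasurableSpace α]
  [MeasurableSingletonClass α] in
lemma seqBlock_extendByInput {n : ℕ} (Y : Ω → Fin n → α) :
    seqBlock (extendByInput X Y) 0 n = Y := by
  funext ω j
  simp [seqBlock, extendByInput]

omit [Fintype α] [Nonempty α] [MeasurableSingletonClass α] in
lemma measurable_extendByInput (hX : ∀ i, Measurable (X i)) {n : ℕ} {Y : Ω → Fin n → α}
    (hY : Measurable Y) (i : ℕ) : Measurable (extendByInput X Y i) := by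
  by_cases h : i < n
  · have : extendByInput X Y i = fun ω => Y ω ⟨i, h⟩ := funext fun ω => dif_pos h
    rw [this]
    exact (measurable_pi_apply _).comp hY
  · have : extendByInput X Y i = positivePart X i := funext fun ω => dif_neg h
    rw [this]
    exact hX _

omit [Nonempty α] in
-- Continuing by the true input, rather than by a constant letter, keeps every channel probability
-- positive, as the gap inequalities demand at all times.
lemma ae_extendByInput_pos (hW : IsChannel W) (hX : ∀ i, Measurable (X i))
    (hZ : ∀ i, Measurable (Z i)) (hXZ : IsMemorylessOutput μ X Z W) {n : ℕ} {Y : Ω → Fin n → α}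
    (h : ∀ᵐ ω ∂μ, 0 < blockChannel W (Y ω) (block Z n ω)) :
    ∀ᵐ ω ∂μ, ∀ i, 0 < W (extendByInput X Y i ω) (positivePart Z i ω) := by
  filter_upwards [h, hXZ.ae_pos hX hZ] with ω h1 h2 i
  by_cases hi : i < n
  · rw [extendByInput_of_lt _ _ hi]
    exact lt_of_le_of_ne (hW.nonneg _ _)
      (Finset.prod_ne_zero_iff.1 h1.ne' ⟨i, hi⟩ (Finset.mem_univ _)).symm
  · rw [extendByInput, dif_neg hi]
    exact h2 _

omit [Nonempty α] in
lemma integral_blockLoss (hX : ∀ i, Measurable (X i)) (Λ : α → α → ℝ) {n : ℕ}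
    {Y : Ω → Fin n → α} (hY : Measurable Y) :
    ∫ ω, blockLoss Λ (block X n ω) (Y ω) ∂μ = (∑ i ∈ Finset.range n,
      ∫ ω, Λ (positivePart X i ω) (extendByInput X Y i ω) ∂μ) / n := by
  have h1 : ∀ ω, blockLoss Λ (block X n ω) (Y ω) =
      (∑ i ∈ Finset.range n, Λ (positivePart X i ω) (extendByInput X Y i ω)) / n := fun ω => by
    rw [blockLoss, Finset.sum_range]
    simp [extendByInput, block, positivePart]
  simp only [h1]
  rw [integral_div, integral_finsetSum]
  exact fun i _ => integrable_comp_fintype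
    ((hX _).prodMk (measurable_extendByInput hX hY i)) fun t => Λ t.1 t.2

/-- The limit of the expected loss: both letters are drawn from the posterior. -/
noncomputable def posteriorLoss (μ : Measure Ω) [IsProbabilityMeasure μ] (X : ℤ → Ω → α)
    (Z : ℤ → Ω → β) (Λ : α → α → ℝ) : ℝ :=
  ∫ z, ∫ p : α × α, Λ p.1 p.2 ∂((posterior μ X Z z).prod (posterior μ X Z z)) ∂(μ.map (path Z))

/-- The expected loss at block length `n`, compared with the limiting loss through the
normalized divergence of the reconstruction. -/
lemma exists_abs_sum_loss_sub_le (hX : ∀ i, Measurable (X i)) (hZ : ∀ i, Measurable (Z i))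
    (hW : IsChannel W) (hXZ : IsMemorylessOutput μ X Z W) (hinv : LinearIndependent ℝ W.row)
    (hst : IsStationary μ fun i ω => (X i ω, Z i ω)) {k : ℕ} {η : ℝ}
    (hk : ∀ᵐ z ∂(μ.map (path Z)), ∀ x,
      |(windowPosterior μ X Z k (window k z)).real {x} - (posterior μ X Z z).real {x}| ≤ η)
    (Λ : α → α → ℝ) {b : ℝ} (hΛ : ∀ x y, |Λ x y| ≤ b) :
    ∃ C, 0 ≤ C ∧ ∀ (M : ℕ) (Y : Ω → Fin (M + 2 * k) → α), Measurable Y →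
      IsMarkovChain μ (block X (M + 2 * k)) (block Z (M + 2 * k)) Y →
      (∀ᵐ ω ∂μ, 0 < blockChannel W (Y ω) (block Z (M + 2 * k) ω)) → ∀ ε : ℝ, 0 < ε →
      |∑ i ∈ Finset.range (M + 2 * k),
        (∫ ω, Λ (positivePart X i ω) (extendByInput X Y i ω) ∂μ - posteriorLoss μ X Z Λ)| ≤
        2 * k * (b + |posteriorLoss μ X Z Λ|) +
          M * (2 * ((∑ t : α × α, |Λ t.1 t.2|) * η) + C * (2 * ε)) +
          C * ((2 * k + 1) * channelGap μ W (positivePart Z) (extendByInput X Y) 0 (M + 2 * k) /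
            (2 * ε)) := by
  obtain ⟨C, hC, h⟩ := exists_abs_integral_seqBlock_sub_le hW hinv hX hZ hXZ hst
    (blockWindowLoss μ X Z Λ k)
  refine ⟨C, hC, fun M Y hY hM hpos ε hε => ?_⟩
  have hV := measurable_extendByInput hX hY
  have hp := ae_extendByInput_pos hW hX hZ hXZ hpos
  have hcenter := abs_integral_windowLoss_sub_le hX hZ hk Λ
  rw [← integral_blockWindowLoss_block hX hZ hst] at hcenter
  change |_ - posteriorLoss μ X Z Λ| ≤ _ at hcenter
  have hbound : ∀ i, |∫ ω, Λ (positivePart X i ω) (extendByInput X Y i ω) ∂μ| ≤ b := fun i => by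
    have := norm_integral_le_of_norm_le_const (μ := μ) (C := b)
      (f := fun ω => Λ (positivePart X i ω) (extendByInput X Y i ω))
      (Eventually.of_forall fun ω => hΛ _ _)
    simpa using this
  refine (abs_sum_range_le (b := b + |posteriorLoss μ X Z Λ|) fun i _ => ?_).trans ?_
  · exact (abs_sub _ _).trans (add_le_add_left (hbound i) _)
  -- Three comparisons: true loss with window loss, `Y` with `X` inside the window loss, and window
  -- loss at `X` with the limit. The first and the last each cost the mixing error, hence the factor
  -- `2`.
  have hterm : ∀ a ∈ Finset.range M,
      |∫ ω, Λ (positivePart X (a + k) ω) (extendByInput X Y (a + k) ω) ∂μ -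
        posteriorLoss μ X Z Λ| ≤ (2 * ((∑ t : α × α, |Λ t.1 t.2|) * η) + C * (2 * ε)) +
          C / (2 * ε) * channelGap μ W (positivePart Z) (extendByInput X Y) a (2 * k + 1) := by
    intro a ha
    have h1 := abs_integral_loss_sub_blockWindowLoss_le hX hZ hst hk Λ hY hM
      (V := extendByInput X Y) (extendByInput_of_lt Y) (a := a)
      (by have := Finset.mem_range.1 ha; omega)
    have h2 := h _ hV hp a ε hε
    have h3 := abs_le.1 h1
    have h4 := abs_le.1 h2
    have h5 := abs_le.1 hcenter
    have h6 : C * (channelGap μ W (positivePart Z) (extendByInput X Y) a (2 * k + 1) / (2 * ε) +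
        2 * ε) = C / (2 * ε) * channelGap μ W (positivePart Z) (extendByInput X Y) a (2 * k + 1) +
          C * (2 * ε) := by ring
    rw [h6] at h4
    exact abs_le.2 ⟨by linarith, by linarith⟩
  have hsum := Finset.sum_le_sum hterm
  rw [Finset.sum_add_distrib, Finset.sum_const, Finset.card_range, nsmul_eq_mul,
    ← Finset.mul_sum] at hsum
  have hgap := sum_channelGap_le (U := positivePart Z) hW (fun i => hZ _) hV hp M (2 * k)
  have hgap' := mul_le_mul_of_nonneg_left hgap (show 0 ≤ C / (2 * ε) by positivity)
  push_cast at hgap'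
  have h7 : C * ((2 * k + 1) * channelGap μ W (positivePart Z) (extendByInput X Y) 0 (M + 2 * k) /
      (2 * ε)) = C / (2 * ε) * ((2 * k + 1) *
        channelGap μ W (positivePart Z) (extendByInput X Y) 0 (M + 2 * k)) := by ring
  rw [h7]
  linarith

/-- Good reconstructions at the matched distortion level lose asymptotically as much as a sample
from the posterior. -/
lemma tendsto_integral_blockLoss (hX : ∀ i, Measurable (X i)) (hZ : ∀ i, Measurable (Z i))
    (hW : IsChannel W) (hXZ : IsMemorylessOutput μ X Z W) (hinv : LinearIndependent ℝ W.row)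
    (hmix : IsDoubleSidedMixing μ X Z) (Λ : α → α → ℝ) {Y : (n : ℕ) → Ω → Fin n → α}
    (hY : ∀ n, Measurable (Y n)) (hM : ∀ n, IsMarkovChain μ (block X n) (block Z n) (Y n))
    (hgood : IsGood μ Z (channelDistortion W) (ENNReal.ofReal (condEntropy μ (Z 0) (X 0))) Y) :
    Tendsto (fun n : ℕ => ∫ ω, blockLoss Λ (block X n ω) (Y n ω) ∂μ) atTop
      (𝓝 (posteriorLoss μ X Z Λ)) := by
  set T := posteriorLoss μ X Z Λ with hT
  set K := ∑ t : α × α, |Λ t.1 t.2| with hK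
  have hK0 : 0 ≤ K := Finset.sum_nonneg fun _ _ => abs_nonneg _
  have hΛ : ∀ x y, |Λ x y| ≤ K := fun x y =>
    Finset.single_le_sum (f := fun t : α × α => |Λ t.1 t.2|) (fun _ _ => abs_nonneg _)
      (Finset.mem_univ (x, y))
  rw [Metric.tendsto_atTop']
  intro δ hδ
  -- The mixing error, the `ε` term, the gap term and the edge terms each get `δ / 5`. The order of
  -- choice matters: `C` depends on `k`, then `ε` on `C`, then `ζ` on all of these, and `n` comes
  -- last. The `+ 1` in the denominators covers vanishing `K`, `C` or `Q`.
  obtain ⟨k, hk⟩ := (hmix.eventually_abs_sub_le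
    (show 0 < δ / (10 * (K + 1)) by positivity)).exists
  obtain ⟨C, hC, hmain⟩ := exists_abs_sum_loss_sub_le hX hZ hW hXZ hinv hmix.stationary hk Λ hΛ
  have h2K : 2 * (K * (δ / (10 * (K + 1)))) ≤ δ / 5 := by
    rw [mul_div_assoc', mul_div_assoc', div_le_div_iff₀ (by positivity) (by positivity)]
    nlinarith
  set ε := δ / (10 * (C + 1)) with hε
  have hε0 : 0 < ε := by positivity
  have h2C : C * (2 * ε) ≤ δ / 5 := by
    rw [hε, mul_div_assoc', mul_div_assoc', div_le_div_iff₀ (by positivity) (by positivity)]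
    nlinarith
  -- `Q` is the total factor in front of the gap of the whole block.
  set Q := C * ((2 * k + 1) / (2 * ε)) with hQ
  have hQ0 : 0 ≤ Q := by positivity
  set ζ := δ / (5 * (Q + 1)) with hζ
  have hQζ : Q * ζ ≤ δ / 5 := by
    rw [hζ, mul_div_assoc', div_le_div_iff₀ (by positivity) (by positivity)]
    nlinarith
  have hg := hgood.eventually_le hW hX hZ hXZ hmix.stationary hY (show 0 < ζ by positivity)
  obtain ⟨n₀, hn₀⟩ := (hg.and ((eventually_ge_atTop (2 * k)).and
    ((tendsto_natCast_atTop_atTop (R := ℝ)).eventually_gt_atTop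
      (5 * (2 * k * (K + |T|)) / δ)))).exists_forall_of_atTop
  refine ⟨max n₀ 0, fun n hn => ?_⟩
  obtain ⟨⟨hpos, hgap⟩, hkn, hnl⟩ := hn₀ n ((le_max_left _ _).trans hn.le)
  have hn0 : (0 : ℝ) < n := by
    have : 0 < n := (le_max_right n₀ 0).trans_lt hn
    positivity
  obtain ⟨M, rfl⟩ := Nat.exists_eq_add_of_le' hkn
  have h1 := hmain M (Y _) (hY _) (hM _) hpos ε hε0
  have h2 := channelGap_le (μ := μ) (W := W) (U := positivePart Z)
    (V := extendByInput X (Y (M + 2 * k))) (fun i => hZ _) (measurable_extendByInput hX (hY _)) 0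
    (M + 2 * k)
  rw [seqBlock_extendByInput, seqBlock_positivePart_zero] at h2
  have h3 := h2.trans hgap
  set n := M + 2 * k with hn
  rw [Real.dist_eq, integral_blockLoss hX Λ (hY n)]
  rw [Finset.sum_sub_distrib, Finset.sum_const, Finset.card_range, nsmul_eq_mul] at h1
  rw [div_sub' hn0.ne', abs_div, abs_of_pos hn0, div_lt_iff₀ hn0]
  refine h1.trans_lt ?_
  have hMn : (M : ℝ) ≤ n := by exact_mod_cast (show M ≤ n by omega)
  have t1 : 2 * k * (K + |T|) < n * (δ / 5) := by
    rw [div_lt_iff₀ hδ] at hnl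
    linarith
  have t2 : M * (2 * (K * (δ / (10 * (K + 1)))) + C * (2 * ε)) ≤ n * (δ / 5 + δ / 5) :=
    mul_le_mul hMn (add_le_add h2K h2C) (by positivity) hn0.le
  have t3 : C * ((2 * k + 1) * channelGap μ W (positivePart Z) (extendByInput X (Y n)) 0 n /
      (2 * ε)) ≤ n * (δ / 5) := by
    have e1 : C * ((2 * k + 1) * channelGap μ W (positivePart Z) (extendByInput X (Y n)) 0 n /
      (2 * ε)) = Q * channelGap μ W (positivePart Z) (extendByInput X (Y n)) 0 n := by
      rw [hQ]; ring
    rw [e1]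
    calc _ ≤ Q * (n * ζ) := mul_le_mul_of_nonneg_left h3 hQ0
      _ = n * (Q * ζ) := by ring
      _ ≤ n * (δ / 5) := mul_le_mul_of_nonneg_left hQζ hn0.le
  have t4 : 0 < (n : ℝ) * δ := by positivity
  linarith

end Main

end Denoising

theorem mainTheorem1
    {A B Ω : Type*}
    [Fintype A] [Nonempty A] [MeasurableSpace A] [MeasurableSingletonClass A]
    [Fintype B] [MeasurableSpace B] [MeasurableSingletonClass B]
    [MeasurableSpace Ω] (μ : Measure Ω) [IsProbabilityMeasure μ]
    (X : ℤ → Ω → A) (hXmeas : ∀ i, Measurable (X i))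
    (Z : ℤ → Ω → B) (hZmeas : ∀ i, Measurable (Z i))
    (hX : Denoising.IsStationaryErgodic μ X)
    (W : Matrix A B ℝ) (hW : Denoising.IsChannel W)
    (hXZ : Denoising.IsMemorylessOutput μ X Z W)
    (hWinv : LinearIndependent ℝ W.row)
    (hmix : Denoising.IsDoubleSidedMixing μ X Z)
    (Λ : A → A → ℝ) (Λmax : ℝ) (hΛ : ∀ x y, Λ x y ∈ Set.Icc 0 Λmax)
    (Y : (n : ℕ) → Ω → Fin n → A) (hYmeas : ∀ n, Measurable (Y n))
    (hMarkov : ∀ n, Denoising.IsMarkovChain μ (Denoising.block X n) (Denoising.block Z n) (Y n))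
    (hgood : Denoising.IsGood μ Z (Denoising.channelDistortion W)
      (ENNReal.ofReal (Denoising.condEntropy μ (Z 0) (X 0))) Y) :
    Tendsto (fun n : ℕ => ∫ ω, Denoising.blockLoss Λ (Denoising.block X n ω) (Y n ω) ∂μ) atTop
      (𝓝 (∫ z, ∫ p : A × A, Λ p.1 p.2
          ∂((Denoising.posterior μ X Z z).prod (Denoising.posterior μ X Z z))
        ∂(μ.map (Denoising.path Z)))) := by
  exact Denoising.tendsto_integral_blockLoss hXmeas hZmeas hW hXZ hWinv hmix Λ hYmeas hMarkov hgood
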